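/- Let $d\ge 1$ and let $\alpha_1,\dots,\alpha_d$ be simultaneously diophantine real numbers, i.e. there exist $\nu>0$ and $C>0$ such that $$\max(\|q\alpha_1\|,\dots,\|q\alpha_d\|)>\frac{C}{q^{1+\nu}}\qquad\text{for every integer } q\ge 1,$$ where $\|x\|$ denotes the distance from $x$ to $\mathbb Z$. Let $\xi$ be a $1$-periodic $C^1$ vector field on $\mathbb R$ with flow $(f^t)_{t\in\mathbb R}$, and assume that $f^t$ is $C^\infty$ for every $t\in\langle\alpha\rangle:=\mathbb Z+\alpha_1\mathbb Z+\dots+\alpha_d\mathbb Z$. Say that a family $\mathcal F$ of maps $\mathbb R\to\mathbb R$ commuting with the unit translation is $C^r$-bounded if every $g\in\mathcal F$ is $C^r$ and $$\sup_{g\in\mathcal F}\ \max_{0\le j\le r}\ \sup_{x\in\mathbb R}\,|D^j(g-\mathrm{id})(x)|<\infty.$$ Then there exists a set $\mathcal T\subset\langle\alpha\rangle\cap[0,1]$, dense in $[0,1]$, such that for every integer $r\ge 1$ the family $\{f^t : t\in\mathcal T\}$ is $C^{r+1}$-bounded. Consequently, for every integer $r\ge 1$, $f^t$ is $C^r$ for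 every $t\in\mathbb R$ and the family $\{f^t : t\in[0,1]\}$ is $C^r$-bounded. -/

import Mathlib

open Set
open scoped ContDiff ENNReal NNReal

/-- The distance `‖x‖` from a real number `x` to `ℤ`. -/
noncomputable def distInt (x : ℝ) : ℝ :=
  |x - (round x : ℝ)|

/-- `α₁, …, α_d` are simultaneously diophantine: there are `ν > 0` and `C > 0` such that
`max (‖q α₁‖, …, ‖q α_d‖) > C / q ^ (1 + ν)` for every positive integer `q`. -/
def SimultaneouslyDiophantine {d : ℕ} (α : Fin d → ℝ) : Prop :=
  ∃ ν : ℝ, 0 < ν ∧ ∃ C : ℝ, 0 < C ∧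
    ∀ q : ℕ, 1 ≤ q → C / (q : ℝ) ^ (1 + ν) < ⨆ i : Fin d, distInt ((q : ℝ) * α i)

/-- The set `ℤ + α₁ ℤ + ⋯ + α_d ℤ`. -/
def integerSpan {d : ℕ} (α : Fin d → ℝ) : Set ℝ :=
  {t : ℝ | ∃ (m : ℤ) (n : Fin d → ℤ), t = (m : ℝ) + ∑ i, (n i : ℝ) * α i}

/-- `(f t)_{t ∈ ℝ}` is the flow on `ℝ` of the (complete) vector field `u ∂_x`: for every `x`, the
curve `t ↦ f t x` is the solution of `y' = u(y)` with value `x` at time `0`, defined for all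
times. For `u` of class `C¹` there is at most one such `f`. -/
def IsFlowOf (u : ℝ → ℝ) (f : ℝ → ℝ → ℝ) : Prop :=
  ∀ x : ℝ, f 0 x = x ∧ IsIntegralCurve (fun t : ℝ => f t x) (fun _ : ℝ => u)

/-- `‖φ‖_r = max_{0 ≤ j ≤ r} sup_{x ∈ ℝ} |D^j φ (x)|`, with values in `[0, ∞]`; it is meant for
functions `φ` of class `C^r`. -/
noncomputable def crNorm (r : ℕ) (φ : ℝ → ℝ) : ℝ≥0∞ :=
  ⨆ j ∈ Finset.range (r + 1), ⨆ x : ℝ, ‖iteratedDeriv j φ x‖ₑ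

/-- A family `F` of lifts of circle maps (maps of `ℝ` that commute with the unit translation, so
that `g - id` is `1`-periodic for `g ∈ F`) is `C^r`-bounded if its members are of class `C^r` and
the `C^r` norms of the functions `g - id`, for `g ∈ F`, have a common finite bound. -/
def CrBounded (r : ℕ) (F : Set (ℝ → ℝ)) : Prop :=
  (∀ g ∈ F, ContDiff ℝ r g) ∧
    ∃ C : ℝ≥0, ∀ g ∈ F, crNorm r (fun x : ℝ => g x - x) ≤ C

/-!
# Smoothness of a flow from the smoothness of its maps at diophantine times

Write `φ_t = f^t - id` and let `G = ℤ + α₁ ℤ + ⋯ + α_d ℤ`. As the field is `C¹` and periodic, `φ_t`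
and `Dφ_t` are `O(|t|)`; the point is to control the higher derivatives for suitable `t ∈ G`.

*Composition is linear in the top derivative.* By interpolation between the orders `1` and `r`,
the derivative `D^r (φ_t ∘ f^s)` is `O(|t| (1 + ‖D^r φ_s‖) + ‖D^r φ_t‖)` (`exists_comp_bound`). Since
`φ_{s + t} = φ_t ∘ f^s + φ_s`, a discrete Grönwall argument shows that the size of `D^r φ_{s + a t}`
is at most that of `D^r φ_s` plus `a` times that of `D^r φ_t`, up to a constant, as long as `s` and
`a t` stay bounded (`SmoothTimes.exists_iterate_bound`).

*Arithmetic.* Let `w ∈ G` be small. Reduce a generator `e ∈ {1, α₁, …, α_d}` modulo `w`, and then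
approximate the quotient of the remainder by `w` with a denominator `O(1 / w)`: this produces an
element of `G` of size at most `w²`. If all these elements were smaller than a large fixed power of
`w`, then `1` and the `α_i` would be almost commensurable, against the diophantine condition. So one
of them is between `w ^ B` and `w ^ 2` (`SimultaneouslyDiophantine.exists_reduction`). Only boundedly
many iterations of bounded total time are involved, so the `r`-th derivatives lose no more than a
factor `O(w⁻²)`, with an exponent that does not depend on `r`. Repeating this yields times `w_k ∈ G`
with `w_k ^ B ≤ w_{k+1} ≤ w_k ^ 2` and `D^r φ_{w_k} = O(w_k⁻⁴)` for all `r`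
(`SmoothTimes.exists_times`).

*Interpolation.* For `a w_{k+1} ≤ w_k`, the bound `φ = O(w_k)` at order `0` and a bound by a fixed
negative power of `w_k` at an arbitrarily high order give `D^r φ_{a w_{k+1}} = O(√w_k)`, for every
`r` (`SmoothTimes.exists_close_to_id`). These errors are summable, so the maps at the times obtained
by expanding `x ∈ [0, 1]` greedily along `(w_k)` have bounded derivatives, and they converge together
with all their derivatives, uniformly in `x` (`SmoothTimes.exists_uniform_bound`). The truncated
expansions form the dense set of times, and their limits are all the maps `f^x`, `x ∈ [0, 1]`.
-/

/-! ### Interpolation and composition estimates on the line -/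

/-- The supremum `sup_x |D^j ψ (x)|`. As a real supremum it is `0` when `D^j ψ` is unbounded; it is
only used for functions whose derivative of order `j` is bounded. -/
noncomputable def supDeriv (j : ℕ) (ψ : ℝ → ℝ) : ℝ :=
  ⨆ x : ℝ, |iteratedDeriv j ψ x|

/-- Smooth functions all of whose derivatives, of order `0` included, are bounded. -/
def SmoothBounded (ψ : ℝ → ℝ) : Prop :=
  ContDiff ℝ ∞ ψ ∧ ∀ j : ℕ, BddAbove (range fun x : ℝ => |iteratedDeriv j ψ x|)

lemma supDeriv_nonneg (j : ℕ) (ψ : ℝ → ℝ) : 0 ≤ supDeriv j ψ :=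
  Real.iSup_nonneg fun _ => abs_nonneg _

lemma SmoothBounded.abs_le {ψ : ℝ → ℝ} (h : SmoothBounded ψ) (j : ℕ) (x : ℝ) :
    |iteratedDeriv j ψ x| ≤ supDeriv j ψ :=
  le_ciSup (h.2 j) x

lemma supDeriv_le {j : ℕ} {ψ : ℝ → ℝ} {B : ℝ} (h : ∀ x, |iteratedDeriv j ψ x| ≤ B) :
    supDeriv j ψ ≤ B :=
  ciSup_le h

lemma ContDiff.iteratedDeriv_smooth {ψ : ℝ → ℝ} (h : ContDiff ℝ ∞ ψ) (j : ℕ) :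
    ContDiff ℝ ∞ (iteratedDeriv j ψ) := by
  rw [iteratedDeriv_eq_iterate]
  exact h.iterate_deriv j

lemma SmoothBounded.deriv {ψ : ℝ → ℝ} (h : SmoothBounded ψ) : SmoothBounded (deriv ψ) := by
  refine ⟨by simpa using h.1.iteratedDeriv_smooth 1, fun j => ?_⟩
  simpa only [← iteratedDeriv_succ'] using h.2 (j + 1)

lemma supDeriv_deriv (j : ℕ) (ψ : ℝ → ℝ) : supDeriv j (deriv ψ) = supDeriv (j + 1) ψ := by
  simp only [supDeriv, iteratedDeriv_succ']

/-- A smooth `1`-periodic function has bounded derivatives of all orders. -/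
lemma SmoothBounded.of_periodic {ψ : ℝ → ℝ} (h : ContDiff ℝ ∞ ψ) (hp : Function.Periodic ψ 1) :
    SmoothBounded ψ := by
  refine ⟨h, fun j => ?_⟩
  have hper : Function.Periodic (fun x => |iteratedDeriv j ψ x|) 1 := by
    intro x
    have h1 : (fun z => ψ (z + 1)) = ψ := funext hp
    have h2 := iteratedDeriv_comp_add_const j ψ 1
    rw [h1] at h2
    simp only
    rw [← congrFun h2 x]
  have hc : Continuous (fun x => |iteratedDeriv j ψ x|) :=
    (h.iteratedDeriv_smooth j).continuous.abs
  exact (hper.compact_of_continuous one_ne_zero hc).bddAbove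

/-- Landau's inequality between three consecutive orders. -/
lemma SmoothBounded.landau {ψ : ℝ → ℝ} (hψ : SmoothBounded ψ) (j : ℕ) {h : ℝ} (hh : 0 < h) :
    supDeriv (j + 1) ψ ≤ 2 / h * supDeriv j ψ + h * supDeriv (j + 2) ψ := by
  refine supDeriv_le fun x => ?_
  set g := iteratedDeriv j ψ with hg
  have hsm : ContDiff ℝ ∞ g := hψ.1.iteratedDeriv_smooth j
  have hsm' : ContDiff ℝ ∞ (iteratedDeriv (j + 1) ψ) := hψ.1.iteratedDeriv_smooth (j + 1)
  obtain ⟨c, hc, hcd⟩ := exists_deriv_eq_slope g (lt_add_of_pos_right x hh)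
    hsm.continuous.continuousOn (hsm.differentiable (by simp)).differentiableOn
  rw [hg, ← iteratedDeriv_succ, ← hg, add_sub_cancel_left] at hcd
  have h1 : |iteratedDeriv (j + 1) ψ c| ≤ 2 / h * supDeriv j ψ := by
    rw [hcd, abs_div, abs_of_pos hh, div_mul_eq_mul_div]
    gcongr
    have := hψ.abs_le j (x + h)
    have := hψ.abs_le j x
    calc |g (x + h) - g x| ≤ |g (x + h)| + |g x| := abs_sub _ _
      _ ≤ _ := by linarith
  have h2 : |iteratedDeriv (j + 1) ψ x - iteratedDeriv (j + 1) ψ c| ≤ h * supDeriv (j + 2) ψ := by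
    have := (convex_univ (𝕜 := ℝ) (E := ℝ)).norm_image_sub_le_of_norm_deriv_le
      (f := iteratedDeriv (j + 1) ψ) (C := supDeriv (j + 2) ψ) (x := c) (y := x)
      (fun y _ => (hsm'.differentiable (by simp)).differentiableAt)
      (fun y _ => by rw [← iteratedDeriv_succ]; exact hψ.abs_le (j + 2) y) (mem_univ _) (mem_univ _)
    rw [Real.norm_eq_abs, Real.norm_eq_abs] at this
    have hxc : |x - c| ≤ h := by rw [_root_.abs_le]; constructor <;> linarith [hc.1, hc.2]
    calc _ ≤ _ := this
      _ ≤ supDeriv (j + 2) ψ * h := by gcongr; exact supDeriv_nonneg _ _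
      _ = _ := mul_comm _ _
  have h3 := abs_sub_abs_le_abs_sub (iteratedDeriv (j + 1) ψ x) (iteratedDeriv (j + 1) ψ c)
  linarith

/-- The combinatorial core of the interpolation inequality: Landau inequalities between consecutive
terms bound `m n` by `m 0` and a small multiple of `m (n + 1)`. -/
lemma exists_le_add_of_landau (n : ℕ) : ∀ ε : ℝ, 0 < ε → ∃ C : ℝ, 0 ≤ C ∧ ∀ m : ℕ → ℝ,
    (∀ j, 0 ≤ m j) → (∀ h, 0 < h → ∀ j, m (j + 1) ≤ 2 / h * m j + h * m (j + 2)) →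
    m n ≤ C * m 0 + ε * m (n + 1) := by
  induction n with
  | zero =>
    intro ε hε
    refine ⟨1, zero_le_one, fun m hm _ => ?_⟩
    have := mul_nonneg hε.le (hm (0 + 1))
    linarith
  | succ n ih =>
    intro ε hε
    obtain ⟨C, hC, H⟩ := ih (ε / 8) (by positivity)
    refine ⟨8 * C / ε, by positivity, fun m hm hl => ?_⟩
    have h1 := H m hm hl
    have h2 := hl (ε / 2) (by positivity) n
    have h3 : 2 / (ε / 2) * m n ≤ 2 / (ε / 2) * (C * m 0 + ε / 8 * m (n + 1)) := by gcongr
    have h4 : 2 / (ε / 2) * (C * m 0 + ε / 8 * m (n + 1)) = 4 * C / ε * m 0 + m (n + 1) / 2 := by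
      field_simp
      ring
    have h5 : 8 * C / ε * m 0 = 2 * (4 * C / ε * m 0) := by ring
    linarith

lemma exists_le_of_landau (n : ℕ) : ∃ C : ℝ, 1 ≤ C ∧ ∀ m : ℕ → ℝ,
    (∀ j, 0 ≤ m j) → (∀ h, 0 < h → ∀ j, m (j + 1) ≤ 2 / h * m j + h * m (j + 2)) →
    ∀ j ≤ n, m j ≤ C * (m 0 + m n) := by
  induction n with
  | zero =>
    refine ⟨1, le_rfl, fun m hm _ j hj => ?_⟩
    obtain rfl : j = 0 := by omega
    linarith [hm 0]
  | succ n ih =>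
    obtain ⟨C, hC, H⟩ := ih
    obtain ⟨C', hC', H'⟩ := exists_le_add_of_landau n 1 one_pos
    refine ⟨C * (1 + C'), by nlinarith, fun m hm hl j hj => ?_⟩
    have h0 := hm 0
    have h1 := hm (n + 1)
    rcases Nat.lt_or_ge n j with h | h
    · obtain rfl : j = n + 1 := by omega
      have : 1 ≤ C * (1 + C') := by nlinarith
      nlinarith
    · have h2 := H m hm hl j h
      have h3 := H' m hm hl
      have h4 : m 0 + m n ≤ (1 + C') * (m 0 + m (n + 1)) := by nlinarith [mul_nonneg hC' h1]
      calc m j ≤ C * (m 0 + m n) := h2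
        _ ≤ C * ((1 + C') * (m 0 + m (n + 1))) := by gcongr
        _ = _ := by ring

/-- Hadamard–Kolmogorov interpolation, in scaled form: if `ψ` is of size `A` and `D^n ψ` of size
`A μ^n`, then `D^j ψ` is of size `A μ^j` for the orders `j` in between. -/
lemma exists_interpolation (n : ℕ) : ∃ C : ℝ, 1 ≤ C ∧ ∀ ψ : ℝ → ℝ, SmoothBounded ψ →
    ∀ A μ : ℝ, 0 < μ → supDeriv 0 ψ ≤ A → supDeriv n ψ ≤ A * μ ^ n →
    ∀ j ≤ n, supDeriv j ψ ≤ C * A * μ ^ j := by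
  obtain ⟨C, hC, H⟩ := exists_le_of_landau n
  refine ⟨2 * C, by linarith, fun ψ hψ A μ hμ h0 hn j hj => ?_⟩
  have key := H (fun j => supDeriv j ψ / μ ^ j)
    (fun j => div_nonneg (supDeriv_nonneg _ _) (by positivity)) (fun h hh i => by
      have := hψ.landau i (h := h / μ) (by positivity)
      rw [div_le_iff₀ (by positivity)]
      refine this.trans_eq ?_
      field_simp
      ring) j hj
  rw [div_le_iff₀ (by positivity)] at key
  refine key.trans ?_
  have h1 : supDeriv n ψ / μ ^ n ≤ A := by rwa [div_le_iff₀ (by positivity)]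
  have h2 : supDeriv 0 ψ / μ ^ 0 ≤ A := by simpa using h0
  refine mul_le_mul_of_nonneg_right ?_ (by positivity)
  calc C * (supDeriv 0 ψ / μ ^ 0 + supDeriv n ψ / μ ^ n) ≤ C * (A + A) := by gcongr
    _ = _ := by ring

lemma iteratedDeriv_sub_constant {i : ℕ} (hi : 0 < i) (φ : ℝ → ℝ) (c x : ℝ) :
    iteratedDeriv i (fun y => φ y - c) x = iteratedDeriv i φ x := by
  obtain ⟨l, rfl⟩ := Nat.exists_eq_add_of_le' hi
  rw [iteratedDeriv_succ', iteratedDeriv_succ']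
  congr 1
  funext y
  exact deriv_sub_const c

/-- The derivatives of `φ ∘ F` at one point, when those of `φ` and `F` grow geometrically with the
same ratio `μ`. -/
lemma abs_iteratedDeriv_comp_le_of_geometric {φ F : ℝ → ℝ} (hφ : ContDiff ℝ ∞ φ)
    (hF : ContDiff ℝ ∞ F) {n : ℕ} (hn : 1 ≤ n) {a b μ : ℝ} (hb : 1 ≤ b) (hμ : 0 < μ)
    (x : ℝ) (h1 : ∀ i, 1 ≤ i → i ≤ n → |iteratedDeriv i φ (F x)| ≤ a * μ ^ i)
    (h2 : ∀ i, 1 ≤ i → i ≤ n → |iteratedDeriv i F x| ≤ b * μ ^ (i - 1)) :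
    |iteratedDeriv n (φ ∘ F) x| ≤ n.factorial * a * (b * μ) ^ n := by
  have ha : 0 ≤ a := by
    have := (abs_nonneg _).trans (h1 1 le_rfl hn)
    exact nonneg_of_mul_nonneg_left this (by positivity)
  -- the rescaling `y ↦ y / μ` turns the geometric bounds on `φ` into a uniform one
  set g : ℝ → ℝ := fun y => φ (μ⁻¹ * y) - φ (F x) with hg
  set k : ℝ → ℝ := fun y => μ * F y with hk
  have hgs : ContDiff ℝ ∞ g := (hφ.comp (contDiff_const.mul contDiff_id)).sub contDiff_const
  have hks : ContDiff ℝ ∞ k := contDiff_const.mul hF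
  have hkx : μ⁻¹ * k x = F x := by simp only [hk]; field_simp
  have key := norm_iteratedFDeriv_comp_le (𝕜 := ℝ) (g := g) (f := k) (n := n) (N := ∞) hgs hks
    (by exact_mod_cast le_top) x (C := a) (D := b * μ) (by
      intro i hi
      rw [norm_iteratedFDeriv_eq_norm_iteratedDeriv, Real.norm_eq_abs]
      rcases Nat.eq_zero_or_pos i with rfl | hi0
      · simp [hg, hkx, ha]
      · have e1 : iteratedDeriv i g = fun y => μ⁻¹ ^ i * iteratedDeriv i φ (μ⁻¹ * y) := by
          rw [← iteratedDeriv_comp_const_mul (hφ.of_le (by exact_mod_cast le_top)) μ⁻¹]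
          funext y
          exact iteratedDeriv_sub_constant hi0 _ _ _
        rw [e1]
        simp only
        rw [hkx, abs_mul, abs_of_pos (by positivity)]
        calc μ⁻¹ ^ i * |iteratedDeriv i φ (F x)| ≤ μ⁻¹ ^ i * (a * μ ^ i) := by
              gcongr; exact h1 i hi0 hi
          _ = a := by rw [inv_pow]; field_simp) (by
      intro i hi0 hi
      rw [norm_iteratedFDeriv_eq_norm_iteratedDeriv, Real.norm_eq_abs, hk,
        iteratedDeriv_const_mul_field, abs_mul, abs_of_pos hμ]
      obtain ⟨l, rfl⟩ := Nat.exists_eq_add_of_le' hi0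
      have := h2 (l + 1) hi0 hi
      rw [Nat.add_sub_cancel] at this
      calc μ * |iteratedDeriv (l + 1) F x| ≤ μ * (b * μ ^ l) := by gcongr
        _ = b * μ ^ (l + 1) := by ring
        _ ≤ b ^ (l + 1) * μ ^ (l + 1) := by gcongr; exact le_self_pow₀ hb (by omega)
        _ = _ := (mul_pow _ _ _).symm)
  rw [norm_iteratedFDeriv_eq_norm_iteratedDeriv, Real.norm_eq_abs] at key
  have e2 : g ∘ k = fun y => (φ ∘ F) y - φ (F x) := by
    funext y
    simp only [hg, hk, Function.comp_apply]
    congr 2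
    field_simp
  rwa [e2, iteratedDeriv_sub_constant (by omega)] at key

/-- A composition estimate that is linear in the top order derivatives. If `Dφ = O(τ)`,
`DF = O(1)`, `D^r φ = O(Y)` and `D^r F = O(X)`, then `D^r (φ ∘ F) = O(τ X + Y)`: by interpolation,
the intermediate derivatives of `Dφ / τ` and `DF` grow at most geometrically, with a ratio `μ`
such that `μ ^ (r - 1) = X + Y / τ`. -/
lemma exists_comp_bound {r : ℕ} (hr : 1 ≤ r) {K : ℝ} (hK : 1 ≤ K) :
    ∃ C : ℝ, 0 ≤ C ∧ ∀ φ F : ℝ → ℝ, SmoothBounded φ → ContDiff ℝ ∞ F → SmoothBounded (deriv F) →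
      ∀ τ X Y : ℝ, 0 < τ → 1 ≤ X → 0 ≤ Y → supDeriv 1 φ ≤ K * τ → supDeriv 1 F ≤ K →
      supDeriv r φ ≤ Y → supDeriv r F ≤ X →
      ∀ x, |iteratedDeriv r (φ ∘ F) x| ≤ C * (τ * X + Y) := by
  obtain ⟨n, rfl⟩ := Nat.exists_eq_add_of_le' hr
  obtain ⟨C₁, hC₁, hint⟩ := exists_interpolation n
  set b := C₁ * K with hb
  have hb1 : 1 ≤ b := by nlinarith
  refine ⟨(n + 1).factorial * b * b ^ (n + 1), by positivity,
    fun φ F hφ hF hF' τ X Y hτ hX hY h1φ h1F hrφ hrF x => ?_⟩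
  obtain ⟨μ, hμ, hYμ, hXμ, hμ'⟩ : ∃ μ : ℝ, 0 < μ ∧ supDeriv (n + 1) φ ≤ K * τ * μ ^ n ∧
      supDeriv (n + 1) F ≤ K * μ ^ n ∧ μ ^ n * τ ≤ τ * X + Y := by
    rcases Nat.eq_zero_or_pos n with rfl | hn
    · refine ⟨1, one_pos, by simpa using h1φ, by simpa using h1F, ?_⟩
      nlinarith
    · have hZ : 0 < X + Y / τ := by positivity
      have e : τ * (X + Y / τ) = τ * X + Y := by field_simp
      have e1 : 0 ≤ τ * X := by positivity
      have e2 : 0 ≤ Y / τ := by positivity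
      refine ⟨(X + Y / τ) ^ (n⁻¹ : ℝ), by positivity, ?_⟩
      rw [Real.rpow_inv_natCast_pow hZ.le (by omega)]
      refine ⟨hrφ.trans ?_, hrF.trans (by nlinarith), by linarith⟩
      rw [mul_assoc, e]
      nlinarith
  have bφ := hint (deriv φ) hφ.deriv (K * τ) μ hμ (by rwa [supDeriv_deriv])
    (by rwa [supDeriv_deriv])
  have bF := hint (deriv F) hF' K μ hμ (by rwa [supDeriv_deriv]) (by rwa [supDeriv_deriv])
  have key := abs_iteratedDeriv_comp_le_of_geometric (φ := φ) (F := F) hφ.1 hF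
    (n := n + 1) (by omega) (a := b * τ / μ) hb1 hμ x (by
      intro i hi0 hi
      obtain ⟨l, rfl⟩ := Nat.exists_eq_add_of_le' hi0
      have := bφ l (by omega)
      rw [supDeriv_deriv] at this
      refine (hφ.abs_le _ _).trans (this.trans_eq ?_)
      rw [hb, pow_succ]
      field_simp) (by
      intro i hi0 hi
      obtain ⟨l, rfl⟩ := Nat.exists_eq_add_of_le' hi0
      have := bF l (by omega)
      rw [iteratedDeriv_succ']
      exact (hF'.abs_le _ _).trans this)
  refine key.trans ?_
  calc ((n + 1).factorial : ℝ) * (b * τ / μ) * (b * μ) ^ (n + 1)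
      = (n + 1).factorial * b * b ^ (n + 1) * (μ ^ n * τ) := by
        rw [mul_pow, pow_succ μ]
        field_simp
    _ ≤ _ := by gcongr

/-! ### Elementary estimates for the flow -/

/-- The displacement `f t - id` of the time-`t` map. -/
def displacement (f : ℝ → ℝ → ℝ) (t : ℝ) : ℝ → ℝ := fun x => f t x - x

lemma exists_bound_of_periodic {u : ℝ → ℝ} (hu : ContDiff ℝ 1 u) (hper : Function.Periodic u 1) :
    ∃ K : ℝ≥0, LipschitzWith K u ∧ ∀ x, |u x| ≤ K := by
  obtain ⟨B, hB⟩ := (hper.compact_of_continuous one_ne_zero hu.continuous).isBounded.exists_norm_le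
  have hc : Continuous (deriv u) := (contDiff_one_iff_deriv.1 hu).2
  have hp : Function.Periodic (deriv u) 1 := fun x => by
    rw [← deriv_comp_add_const, show (fun x => u (x + 1)) = u from funext hper]
  obtain ⟨B', hB'⟩ := (hp.compact_of_continuous one_ne_zero hc).isBounded.exists_norm_le
  refine ⟨(|B| + |B'|).toNNReal, ?_, fun x => ?_⟩
  · refine lipschitzWith_of_nnnorm_deriv_le (hu.differentiable one_ne_zero) fun x => ?_
    rw [← NNReal.coe_le_coe, coe_nnnorm, Real.coe_toNNReal _ (by positivity)]
    have := hB' _ (mem_range_self x)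
    have h1 := le_abs_self B'
    have h2 := abs_nonneg B
    linarith
  · have := hB _ (mem_range_self x)
    rw [Real.norm_eq_abs] at this
    rw [Real.coe_toNNReal _ (by positivity)]
    have h1 := le_abs_self B
    have h2 := abs_nonneg B'
    linarith

namespace IsFlowOf

variable {u : ℝ → ℝ} {f : ℝ → ℝ → ℝ} {K : ℝ≥0}

lemma hasDerivAt (hf : IsFlowOf u f) (x t : ℝ) : HasDerivAt (fun s => f s x) (u (f t x)) t :=
  (hf x).2 t

lemma eq_of_eq (hL : LipschitzWith K u) {γ γ' : ℝ → ℝ}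
    (hγ : ∀ t, HasDerivAt γ (u (γ t)) t) (hγ' : ∀ t, HasDerivAt γ' (u (γ' t)) t)
    (h0 : γ 0 = γ' 0) : γ = γ' :=
  ODE_solution_unique_univ (v := fun _ => u) (s := fun _ => univ) (t₀ := 0)
    (fun _ => hL.lipschitzOnWith) (fun t => ⟨hγ t, mem_univ _⟩) (fun t => ⟨hγ' t, mem_univ _⟩) h0

lemma add_apply (hf : IsFlowOf u f) (hL : LipschitzWith K u) (s t x : ℝ) :
    f (s + t) x = f s (f t x) := by
  refine congrFun (eq_of_eq (γ := fun s => f (s + t) x) (γ' := fun s => f s (f t x)) hL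
    (fun s => ?_) (fun s => hf.hasDerivAt _ s) ?_) s
  · exact (hf.hasDerivAt x (s + t)).comp_add_const s t
  · simp [(hf (f t x)).1]

lemma apply_add_one (hf : IsFlowOf u f) (hL : LipschitzWith K u) (hper : Function.Periodic u 1)
    (t x : ℝ) : f t (x + 1) = f t x + 1 := by
  refine congrFun (eq_of_eq (γ := fun t => f t (x + 1)) (γ' := fun t => f t x + 1) hL
    (fun s => hf.hasDerivAt _ s) (fun s => ?_) ?_) t
  · rw [hper]
    exact (hf.hasDerivAt x s).add_const 1
  · simp [(hf x).1, (hf (x + 1)).1]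

lemma neg (hf : IsFlowOf u f) : IsFlowOf (fun x => -u x) (fun t => f (-t)) := by
  refine fun x => ⟨by simpa using (hf x).1, fun t => ?_⟩
  have h : HasDerivAt (fun s => f s x) (u (f (-t) x)) (0 - t) := by
    rw [zero_sub]
    exact hf.hasDerivAt x (-t)
  simpa only [zero_sub] using h.comp_const_sub 0 t

lemma dist_le_of_nonneg (hf : IsFlowOf u f) (hL : LipschitzWith K u) {t : ℝ} (ht : 0 ≤ t)
    (x y : ℝ) : |f t x - f t y| ≤ Real.exp (K * t) * |x - y| := by
  have hc : ∀ z, Continuous fun s => f s z := fun z =>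
    continuous_iff_continuousAt.2 fun s => (hf.hasDerivAt z s).continuousAt
  have := dist_le_of_trajectories_ODE (v := fun _ => u) (K := K) (a := 0) (b := t)
    (f := fun s => f s x) (g := fun s => f s y) (δ := |x - y|) (fun _ => hL)
    (hc x).continuousOn (fun s _ => (hf.hasDerivAt x s).hasDerivWithinAt)
    (hc y).continuousOn (fun s _ => (hf.hasDerivAt y s).hasDerivWithinAt)
    (by rw [(hf x).1, (hf y).1, Real.dist_eq]) t ⟨ht, le_rfl⟩
  rwa [Real.dist_eq, sub_zero, mul_comm] at this

lemma abs_sub_le (hf : IsFlowOf u f) (hL : LipschitzWith K u) (t x y : ℝ) :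
    |f t x - f t y| ≤ Real.exp (K * |t|) * |x - y| := by
  rcases le_total 0 t with ht | ht
  · rw [abs_of_nonneg ht]
    exact hf.dist_le_of_nonneg hL ht x y
  · have hL' : LipschitzWith K fun x => -u x := hL.neg
    have := hf.neg.dist_le_of_nonneg hL' (neg_nonneg.2 ht) x y
    rwa [neg_neg, ← abs_of_nonpos ht] at this

lemma abs_displacement_le (hf : IsFlowOf u f) {B : ℝ} (hB : ∀ x, |u x| ≤ B) (t x : ℝ) :
    |displacement f t x| ≤ B * |t| := by
  have := convex_univ.norm_image_sub_le_of_norm_hasDerivWithin_le (f := fun s => f s x)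
    (f' := fun s => u (f s x)) (C := B) (x := 0) (y := t)
    (fun s _ => (hf.hasDerivAt x s).hasDerivWithinAt) (fun s _ => hB _) (mem_univ _) (mem_univ _)
  simpa [(hf x).1, displacement] using this

lemma abs_displacement_sub_le (hf : IsFlowOf u f) (hL : LipschitzWith K u) (t x y : ℝ) :
    |displacement f t x - displacement f t y| ≤ K * Real.exp (K * |t|) * |t| * |x - y| := by
  have := (convex_Icc (-|t|) |t|).norm_image_sub_le_of_norm_hasDerivWithin_le
    (f := fun s => f s x - f s y) (f' := fun s => u (f s x) - u (f s y))
    (C := K * (Real.exp (K * |t|) * |x - y|)) (x := 0) (y := t)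
    (fun s _ => ((hf.hasDerivAt x s).sub (hf.hasDerivAt y s)).hasDerivWithinAt)
    (fun s hs => by
      have h1 := hL.dist_le_mul (f s x) (f s y)
      rw [Real.dist_eq, Real.dist_eq] at h1
      rw [Real.norm_eq_abs]
      refine h1.trans ?_
      have h2 := hf.abs_sub_le hL s x y
      have h3 : |s| ≤ |t| := abs_le.2 hs
      gcongr
      exact h2.trans (by gcongr))
    (by simp) (abs_le.1 le_rfl)
  simp only [(hf x).1, (hf y).1, Real.norm_eq_abs, sub_zero] at this
  calc |displacement f t x - displacement f t y| = |f t x - f t y - (x - y)| := by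
        simp only [displacement]; congr 1; ring
    _ ≤ _ := this
    _ = _ := by ring

/-- The `C¹` size of the time-`t` maps: for bounded `t` the displacement and its derivative are
`O(|t|)`. -/
lemma exists_C1_bound (hf : IsFlowOf u f) (hu : ContDiff ℝ 1 u) (hper : Function.Periodic u 1)
    (R : ℝ) : ∃ B : ℝ, 1 ≤ B ∧ ∀ t, |t| ≤ R → supDeriv 0 (displacement f t) ≤ B * |t| ∧
      supDeriv 1 (displacement f t) ≤ B * |t| ∧ supDeriv 1 (f t) ≤ B := by
  obtain ⟨K, hL, hK⟩ := exists_bound_of_periodic hu hper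
  refine ⟨1 + K + K * Real.exp (K * R) + Real.exp (K * R), ?_, fun t ht => ⟨?_, ?_, ?_⟩⟩
  · have : 0 ≤ K + K * Real.exp (K * R) + Real.exp (K * R) := by positivity
    linarith
  · refine supDeriv_le fun x => ?_
    rw [iteratedDeriv_zero]
    refine (hf.abs_displacement_le hK t x).trans ?_
    have : 0 ≤ 1 + K * Real.exp (K * R) + Real.exp (K * R) := by positivity
    gcongr
    linarith
  · refine supDeriv_le fun x => ?_
    rw [iteratedDeriv_one, ← Real.norm_eq_abs]
    refine norm_deriv_le_of_lip' (by positivity) (Filter.Eventually.of_forall fun y => ?_)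
    refine (hf.abs_displacement_sub_le hL t y x).trans ?_
    rw [Real.norm_eq_abs]
    have h1 : Real.exp (K * |t|) ≤ Real.exp (K * R) := by gcongr
    have h2 : K * Real.exp (K * |t|) ≤ K * Real.exp (K * R) := by gcongr
    have h3 : 0 < Real.exp (K * R) := Real.exp_pos _
    have h4 : (0 : ℝ) ≤ K := K.2
    gcongr
    linarith
  · refine supDeriv_le fun x => ?_
    rw [iteratedDeriv_one, ← Real.norm_eq_abs]
    refine norm_deriv_le_of_lip' (by positivity) (Filter.Eventually.of_forall fun y => ?_)
    refine (hf.abs_sub_le hL t y x).trans ?_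
    rw [Real.norm_eq_abs]
    have h1 : Real.exp (K * |t|) ≤ Real.exp (K * R) := by gcongr
    have h2 : 0 ≤ 1 + K + K * Real.exp (K * R) := by positivity
    gcongr
    linarith

lemma displacement_add (hf : IsFlowOf u f) (hL : LipschitzWith K u) (s t : ℝ) :
    displacement f (s + t) = fun x => (displacement f s ∘ f t) x + displacement f t x := by
  funext x
  simp only [displacement, Function.comp_apply, hf.add_apply hL]
  ring

lemma smoothBounded_displacement (hf : IsFlowOf u f) (hL : LipschitzWith K u)
    (hper : Function.Periodic u 1) {t : ℝ} (ht : ContDiff ℝ ∞ (f t)) :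
    SmoothBounded (displacement f t) := by
  refine SmoothBounded.of_periodic (ht.sub contDiff_id) fun x => ?_
  simp only [displacement, hf.apply_add_one hL hper]
  ring


end IsFlowOf

/-! ### Iterating maps at smooth times -/

/-- A flow `f` of a `1`-periodic `C¹` field whose time-`t` maps are smooth for the times `t` of an
additive group `G`. -/
structure SmoothTimes (u : ℝ → ℝ) (f : ℝ → ℝ → ℝ) (G : AddSubgroup ℝ) : Prop where
  flow : IsFlowOf u f
  contDiff_field : ContDiff ℝ 1 u
  periodic : Function.Periodic u 1
  smooth : ∀ t ∈ G, ContDiff ℝ ∞ (f t)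

/-- The size of the `r`-th derivatives of `f t - id` and `f (-t) - id`. -/
noncomputable def symSize (f : ℝ → ℝ → ℝ) (r : ℕ) (t : ℝ) : ℝ :=
  supDeriv r (displacement f t) + supDeriv r (displacement f (-t))

lemma symSize_nonneg (f : ℝ → ℝ → ℝ) (r : ℕ) (t : ℝ) : 0 ≤ symSize f r t :=
  add_nonneg (supDeriv_nonneg _ _) (supDeriv_nonneg _ _)

lemma symSize_neg (f : ℝ → ℝ → ℝ) (r : ℕ) (t : ℝ) : symSize f r (-t) = symSize f r t := by
  rw [symSize, symSize, neg_neg, add_comm]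

lemma symSize_abs (f : ℝ → ℝ → ℝ) (r : ℕ) (t : ℝ) : symSize f r |t| = symSize f r t := by
  rcases abs_choice t with h | h <;> rw [h]
  exact symSize_neg f r t

lemma supDeriv_le_symSize (f : ℝ → ℝ → ℝ) (r : ℕ) (t : ℝ) :
    supDeriv r (displacement f t) ≤ symSize f r t :=
  le_add_of_nonneg_right (supDeriv_nonneg _ _)

namespace SmoothTimes

variable {u : ℝ → ℝ} {f : ℝ → ℝ → ℝ} {G : AddSubgroup ℝ}

lemma smoothBounded (h : SmoothTimes u f G) {t : ℝ} (ht : t ∈ G) :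
    SmoothBounded (displacement f t) := by
  obtain ⟨K, hL, -⟩ := exists_bound_of_periodic h.contDiff_field h.periodic
  exact h.flow.smoothBounded_displacement hL h.periodic (h.smooth t ht)

lemma iteratedDeriv_eq (h : SmoothTimes u f G) {t : ℝ} (ht : t ∈ G) (r : ℕ) (x : ℝ) :
    iteratedDeriv r (f t) x = iteratedDeriv r (displacement f t) x + iteratedDeriv r id x := by
  have e : f t = fun x => displacement f t x + id x := by
    funext x; simp [displacement]
  conv_lhs => rw [e]
  exact iteratedDeriv_fun_add ((h.smoothBounded ht).1.contDiffAt.of_le (by exact_mod_cast le_top))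
    contDiff_id.contDiffAt

lemma abs_iteratedDeriv_succ_le (h : SmoothTimes u f G) {t : ℝ} (ht : t ∈ G) (n : ℕ) (x : ℝ) :
    |iteratedDeriv (n + 1) (f t) x| ≤ 1 + supDeriv (n + 1) (displacement f t) := by
  have h1 : |iteratedDeriv (n + 1) (id : ℝ → ℝ) x| ≤ 1 := by
    rw [iteratedDeriv_succ', deriv_id']
    simp only [iteratedDeriv_const]
    split_ifs <;> simp
  rw [h.iteratedDeriv_eq ht]
  have h2 := (h.smoothBounded ht).abs_le (n + 1) x
  exact (abs_add_le _ _).trans (by linarith)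

lemma smoothBounded_deriv (h : SmoothTimes u f G) {t : ℝ} (ht : t ∈ G) :
    SmoothBounded (deriv (f t)) := by
  refine ⟨by simpa using (h.smooth t ht).iteratedDeriv_smooth 1, fun j => ?_⟩
  refine ⟨1 + supDeriv (j + 1) (displacement f t), ?_⟩
  rintro _ ⟨x, rfl⟩
  simp only
  rw [← iteratedDeriv_succ']
  exact h.abs_iteratedDeriv_succ_le ht j x

/-- The cost, in derivatives of order `r`, of composing `f s` with `f t` for a time `t` of size at
most `τ`. -/
lemma exists_increment_bound (h : SmoothTimes u f G) (r : ℕ) (R : ℝ) :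
    ∃ C : ℝ, 0 ≤ C ∧ ∀ s ∈ G, ∀ t ∈ G, |s| ≤ R → |t| ≤ R → ∀ τ Y : ℝ, 0 < τ → |t| ≤ τ → 0 ≤ Y →
      supDeriv r (displacement f t) ≤ Y → ∀ x, |iteratedDeriv r (displacement f t ∘ f s) x| ≤
        C * (τ * (1 + supDeriv r (displacement f s)) + Y) := by
  obtain ⟨B, hB, hfB⟩ := h.flow.exists_C1_bound h.contDiff_field h.periodic R
  rcases Nat.eq_zero_or_pos r with rfl | hr
  · refine ⟨1, zero_le_one, fun s hs t ht hsR htR τ Y hτ htτ hY htY x => ?_⟩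
    have h1 := (h.smoothBounded ht).abs_le 0 (f s x)
    have h2 : 0 ≤ τ * (1 + supDeriv 0 (displacement f s)) :=
      mul_nonneg hτ.le (add_nonneg zero_le_one (supDeriv_nonneg _ _))
    rw [iteratedDeriv_zero] at h1 ⊢
    simp only [Function.comp_apply]
    linarith
  · obtain ⟨C, hC, H⟩ := exists_comp_bound hr hB
    refine ⟨C, hC, fun s hs t ht hsR htR τ Y hτ htτ hY htY x => ?_⟩
    refine H (displacement f t) (f s) (h.smoothBounded ht) (h.smooth s hs)
      (h.smoothBounded_deriv hs) τ _ Y hτ ?_ hY ((hfB t htR).2.1.trans (by gcongr))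
      (hfB s hsR).2.2 htY ?_ x
    · linarith [supDeriv_nonneg r (displacement f s)]
    · obtain ⟨n, rfl⟩ := Nat.exists_eq_add_of_le' hr
      exact supDeriv_le fun x => h.abs_iteratedDeriv_succ_le hs n x

lemma supDeriv_add_le (h : SmoothTimes u f G) (r : ℕ) {s t : ℝ} (hs : s ∈ G) (ht : t ∈ G)
    {B : ℝ} (hB : ∀ x, |iteratedDeriv r (displacement f t ∘ f s) x| ≤ B) :
    supDeriv r (displacement f (s + t)) ≤ supDeriv r (displacement f s) + B := by
  obtain ⟨K, hL, -⟩ := exists_bound_of_periodic h.contDiff_field h.periodic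
  refine supDeriv_le fun x => ?_
  rw [add_comm s t, h.flow.displacement_add hL, iteratedDeriv_fun_add
    ((((h.smoothBounded ht).1.comp (h.smooth s hs)).of_le (by exact_mod_cast le_top)).contDiffAt)
    (((h.smoothBounded hs).1.of_le (by exact_mod_cast le_top)).contDiffAt)]
  have h1 := hB x
  have h2 := (h.smoothBounded hs).abs_le r x
  exact (abs_add_le _ _).trans (by linarith)

/-- Iterating a time-`t` map `a` times costs only `a` times its size, as long as the total time
`a t` stays bounded. -/
lemma exists_iterate_bound (h : SmoothTimes u f G) (r : ℕ) (R : ℝ) :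
    ∃ C : ℝ, 1 ≤ C ∧ ∀ s ∈ G, ∀ t ∈ G, ∀ a : ℕ, |s| ≤ R → a * |t| ≤ R →
      1 + supDeriv r (displacement f (s + a * t)) ≤
        C * (1 + supDeriv r (displacement f s) + a * supDeriv r (displacement f t)) := by
  obtain ⟨C, hC, H⟩ := h.exists_increment_bound r (2 * R)
  refine ⟨Real.exp (C * |R|) * (1 + C), ?_, fun s hs t ht a hsR htR => ?_⟩
  · have : 1 ≤ Real.exp (C * |R|) := Real.one_le_exp (by positivity)
    nlinarith
  set X := supDeriv r (displacement f s) with hX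
  set Y := supDeriv r (displacement f t) with hY
  have hX0 : 0 ≤ X := supDeriv_nonneg _ _
  have hY0 : 0 ≤ Y := supDeriv_nonneg _ _
  have hexp : 1 ≤ Real.exp (C * |R|) := Real.one_le_exp (by positivity)
  rcases eq_or_ne t 0 with rfl | ht0
  · rw [mul_zero, add_zero]
    have h1 : 0 ≤ a * Y := by positivity
    have h2 : 1 ≤ Real.exp (C * |R|) * (1 + C) := by nlinarith
    nlinarith
  have ht0' : 0 < |t| := abs_pos.2 ht0
  have key : ∀ n ≤ a, 1 + supDeriv r (displacement f (s + n * t)) ≤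
      (1 + C * |t|) ^ n * (1 + X + n * (C * Y)) := by
    intro n
    induction n with
    | zero => intro _; simp [← hX]
    | succ n ih =>
      intro hn
      have hnG : s + n * t ∈ G := by
        rw [← nsmul_eq_mul]
        exact G.add_mem hs (G.nsmul_mem ht n)
      have hna : (n : ℝ) + 1 ≤ a := by exact_mod_cast hn
      have hnt : ((n : ℝ) + 1) * |t| ≤ R := (by gcongr : _ ≤ (a : ℝ) * |t|).trans htR
      have hnt' : (0 : ℝ) ≤ n * |t| := by positivity
      have hb := H (s + n * t) hnG t ht (by
        calc |s + n * t| ≤ |s| + |n * t| := abs_add_le _ _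
          _ = |s| + n * |t| := by rw [abs_mul, Nat.abs_cast]
          _ ≤ 2 * R := by linarith) (by linarith) |t| Y ht0' le_rfl hY0 le_rfl
      have h1 := h.supDeriv_add_le r hnG ht hb
      have h2 := ih (by omega)
      have h3 : s + ((n + 1 : ℕ) : ℝ) * t = s + n * t + t := by push_cast; ring
      rw [h3]
      have h4 : 1 ≤ (1 + C * |t|) ^ (n + 1) := one_le_pow₀ (by linarith [mul_nonneg hC ht0'.le])
      calc 1 + supDeriv r (displacement f (s + n * t + t))
          ≤ (1 + C * |t|) * (1 + supDeriv r (displacement f (s + n * t))) + C * Y := by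
            linarith
        _ ≤ (1 + C * |t|) * ((1 + C * |t|) ^ n * (1 + X + n * (C * Y)))
            + (1 + C * |t|) ^ (n + 1) * (C * Y) := by
            have h5 : 0 ≤ C * Y := by positivity
            exact add_le_add (by gcongr) (le_mul_of_one_le_left h5 h4)
        _ = _ := by push_cast; ring
  have h1 := key a le_rfl
  have h2 : (1 + C * |t|) ^ a ≤ Real.exp (C * |R|) := by
    calc (1 + C * |t|) ^ a ≤ Real.exp (C * |t|) ^ a := by
          gcongr
          linarith [Real.add_one_le_exp (C * |t|)]
      _ = Real.exp (C * (a * |t|)) := by rw [← Real.exp_nat_mul]; congr 1; ring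
      _ ≤ _ := by gcongr; exact htR.trans (le_abs_self R)
  calc 1 + supDeriv r (displacement f (s + a * t))
      ≤ (1 + C * |t|) ^ a * (1 + X + a * (C * Y)) := h1
    _ ≤ Real.exp (C * |R|) * ((1 + C) * (1 + X + a * Y)) := by
        gcongr
        have : 0 ≤ C * (1 + X) := by positivity
        have : 0 ≤ a * Y := by positivity
        linarith
    _ = _ := by ring

lemma exists_symSize_bound (h : SmoothTimes u f G) (r : ℕ) (R : ℝ) :
    ∃ C : ℝ, 1 ≤ C ∧ ∀ s ∈ G, ∀ t ∈ G, ∀ a : ℤ, |s| ≤ R → |(a : ℝ)| * |t| ≤ R →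
      1 + symSize f r (s + a * t) ≤ C * (1 + symSize f r s + |(a : ℝ)| * symSize f r t) := by
  obtain ⟨C, hC, H⟩ := h.exists_iterate_bound r R
  have key : ∀ s ∈ G, ∀ t ∈ G, ∀ a : ℕ, |s| ≤ R → a * |t| ≤ R →
      1 + symSize f r (s + a * t) ≤ 2 * C * (1 + symSize f r s + a * symSize f r t) := by
    intro s hs t ht a hsR htR
    have h1 := H s hs t ht a hsR htR
    have h2 := H (-s) (G.neg_mem hs) (-t) (G.neg_mem ht) a (by rwa [abs_neg]) (by rwa [abs_neg])
    have e : -(s + a * t) = -s + a * -t := by ring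
    have h3 := symSize_nonneg f r s
    have h4 : 0 ≤ a * symSize f r t := mul_nonneg (by positivity) (symSize_nonneg f r t)
    rw [symSize, e]
    simp only [symSize] at *
    nlinarith
  refine ⟨2 * C, by linarith, fun s hs t ht a hsR htR => ?_⟩
  obtain ⟨n, rfl | rfl⟩ := a.eq_nat_or_neg
  · simpa using key s hs t ht n hsR (by simpa using htR)
  · have := key s hs (-t) (G.neg_mem ht) n hsR (by simpa using htR)
    simpa [symSize_neg] using this

end SmoothTimes

/-! ### Reducing the generators modulo a small element -/

/-- `ℤ + α₁ ℤ + ⋯ + α_d ℤ` as an additive group. -/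
def integerSpanSubgroup {d : ℕ} (α : Fin d → ℝ) : AddSubgroup ℝ where
  carrier := integerSpan α
  zero_mem' := ⟨0, 0, by simp⟩
  add_mem' := by
    rintro _ _ ⟨m, n, rfl⟩ ⟨m', n', rfl⟩
    refine ⟨m + m', n + n', ?_⟩
    simp only [Int.cast_add, Pi.add_apply, add_mul, Finset.sum_add_distrib]
    ring
  neg_mem' := by
    rintro _ ⟨m, n, rfl⟩
    refine ⟨-m, -n, ?_⟩
    simp only [Int.cast_neg, Pi.neg_apply, neg_mul, Finset.sum_neg_distrib]
    ring

lemma intCast_mem_integerSpan {d : ℕ} (α : Fin d → ℝ) (m : ℤ) :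
    (m : ℝ) ∈ integerSpanSubgroup α :=
  ⟨m, 0, by simp⟩

lemma one_mem_integerSpan {d : ℕ} (α : Fin d → ℝ) : (1 : ℝ) ∈ integerSpanSubgroup α := by
  simpa using intCast_mem_integerSpan α 1

lemma generator_mem_integerSpan {d : ℕ} (α : Fin d → ℝ) (i : Fin d) :
    α i ∈ integerSpanSubgroup α :=
  ⟨0, Pi.single i 1, by simp [Pi.single_apply]⟩

lemma SimultaneouslyDiophantine.exists_natCast_exponent {d : ℕ} {α : Fin d → ℝ}
    (hα : SimultaneouslyDiophantine α) : ∃ n : ℕ, ∃ C : ℝ, 0 < C ∧ ∀ q : ℕ, 1 ≤ q →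
      ∀ δ : ℝ, (∀ i, ∃ m : ℤ, |q * α i - m| ≤ δ) → 0 ≤ δ → C < δ * (q : ℝ) ^ n := by
  obtain ⟨ν, hν, C, hC, H⟩ := hα
  obtain ⟨n, hn⟩ := exists_nat_ge (1 + ν)
  refine ⟨n, C, hC, fun q hq δ hδ hδ0 => ?_⟩
  have hq1 : (1 : ℝ) ≤ q := by exact_mod_cast hq
  have h1 : ⨆ i : Fin d, distInt ((q : ℝ) * α i) ≤ δ := Real.iSup_le (fun i => by
    obtain ⟨m, hm⟩ := hδ i
    exact (round_le _ m).trans hm) hδ0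
  have h2 := (H q hq).trans_le h1
  rw [div_lt_iff₀ (by positivity)] at h2
  refine h2.trans_le ?_
  gcongr
  rw [← Real.rpow_natCast]
  exact Real.rpow_le_rpow_of_exponent_le hq1 hn

/-- The group generated by `1` and simultaneously diophantine numbers has small elements. -/
lemma SimultaneouslyDiophantine.exists_small_mem {d : ℕ} {α : Fin d → ℝ}
    (hα : SimultaneouslyDiophantine α) {ε : ℝ} (hε : 0 < ε) :
    ∃ t ∈ integerSpanSubgroup α, 0 < t ∧ t ≤ ε := by
  obtain ⟨n, C, hC, H⟩ := hα.exists_natCast_exponent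
  obtain ⟨N, hN⟩ := exists_nat_one_div_lt hε
  have hdir := fun i => Real.exists_int_int_abs_mul_sub_le (α i) (Nat.succ_pos N)
  choose j k hk _ hjk using hdir
  by_contra! hno
  have hzero : ∀ i, (k i : ℝ) * α i = j i := by
    intro i
    by_contra hne
    have hmem : (k i : ℝ) * α i - j i ∈ integerSpanSubgroup α := by
      refine AddSubgroup.sub_mem _ ?_ (intCast_mem_integerSpan α _)
      rw [← zsmul_eq_mul]
      exact AddSubgroup.zsmul_mem _ (generator_mem_integerSpan α i) _
    have hle : |(k i : ℝ) * α i - j i| ≤ ε := by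
      refine (hjk i).trans (le_trans ?_ hN.le)
      push_cast
      gcongr
      linarith
    have hpos : 0 < |(k i : ℝ) * α i - j i| := abs_pos.2 (sub_ne_zero.2 hne)
    refine absurd hle (not_le.2 (hno _ ?_ hpos))
    rcases abs_choice ((k i : ℝ) * α i - j i) with h | h <;> rw [h]
    exacts [hmem, AddSubgroup.neg_mem _ hmem]
  have hkpos : 0 < ∏ i, k i := Finset.prod_pos fun i _ => hk i
  have := H (∏ i, k i).toNat (by omega) 0 (fun i => by
    obtain ⟨c, hc⟩ := Finset.dvd_prod_of_mem k (Finset.mem_univ i)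
    refine ⟨c * j i, ?_⟩
    have e : (((∏ i, k i).toNat : ℕ) : ℝ) = ((∏ i, k i : ℤ) : ℝ) := by
      exact_mod_cast congrArg (Int.cast : ℤ → ℝ) (Int.toNat_of_nonneg hkpos.le)
    rw [e, hc]
    push_cast
    rw [← hzero i]
    ring_nf
    simp) le_rfl
  simp only [zero_mul] at this
  linarith

/-- If `1` and all the `α i` were almost commensurable with `w`, with small denominators, then a
common multiple of the denominators would violate the diophantine condition. -/
lemma SimultaneouslyDiophantine.not_almost_commensurable {d : ℕ} {α : Fin d → ℝ}
    (hα : SimultaneouslyDiophantine α) : ∃ B : ℕ, ∃ w₀ : ℝ, 0 < w₀ ∧ w₀ ≤ 1 / 2 ∧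
      ∀ w : ℝ, 0 < w → w ≤ w₀ → ∀ (k₀ p₀ : ℤ) (k p : Fin d → ℤ),
        0 < k₀ → k₀ * w ≤ 2 → (∀ i, 0 < k i) → (∀ i, k i * w ≤ 2) →
        |k₀ - p₀ * w| < w ^ B → ¬ ∀ i, |k i * α i - p i * w| < w ^ B := by
  obtain ⟨n, C, hC, H⟩ := hα.exists_natCast_exponent
  set R : ℝ := ∑ i, |α i| with hR
  have hR0 : 0 ≤ R := Finset.sum_nonneg fun _ _ => abs_nonneg _
  set E : ℕ := 2 * d + 4 with hE
  refine ⟨2 + E + n * E, min (1 / 2) (C / (1 + R)), by positivity, min_le_left _ _,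
    fun w hw hww k₀ p₀ k p hk₀ hk₀w hk hkw h₀ hi => ?_⟩
  have hw2 : w ≤ 1 / 2 := hww.trans (min_le_left _ _)
  have hwC : (1 + R) * w ≤ C := by
    have := hww.trans (min_le_right _ _)
    rw [le_div_iff₀ (by positivity)] at this
    linarith
  set v : ℝ := w⁻¹ with hv
  have hvw : v * w = 1 := inv_mul_cancel₀ hw.ne'
  have hv2 : 2 ≤ v := by rw [hv, le_inv_comm₀ (by norm_num) hw]; linarith
  have hle : ∀ m : ℤ, (m : ℝ) * w ≤ 2 → (m : ℝ) ≤ v ^ 2 := by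
    intro m hm
    have : (m : ℝ) = v * (m * w) := by linear_combination -(m : ℝ) * hvw
    rw [this]
    nlinarith
  set P : ℤ := ∏ i, k i with hP
  have hP0 : 0 < P := Finset.prod_pos fun i _ => hk i
  have hPR : (0 : ℝ) < P := by exact_mod_cast hP0
  have hk₀R : (1 : ℝ) ≤ k₀ := by exact_mod_cast hk₀
  have hPle : (P : ℝ) ≤ v ^ (2 * d) := by
    rw [hP, Int.cast_prod]
    calc ∏ i, (k i : ℝ) ≤ ∏ _i : Fin d, v ^ 2 :=
          Finset.prod_le_prod (fun i _ => by exact_mod_cast (hk i).le) fun i _ => hle _ (hkw i)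
      _ = _ := by simp [← pow_mul, mul_comm]
  have hQle : (k₀ : ℝ) * P ≤ v ^ (2 * d + 2) := by
    calc (k₀ : ℝ) * P ≤ v ^ 2 * v ^ (2 * d) := by gcongr; exact hle _ hk₀w
      _ = _ := by ring
  set M : ℤ := P * p₀ with hM
  have hwB : w ^ (2 + E + n * E) ≤ 1 / 2 := by
    calc w ^ (2 + E + n * E) ≤ w ^ 1 := pow_le_pow_of_le_one hw.le (by linarith) (by omega)
      _ ≤ _ := by simpa using hw2
  rw [abs_lt] at h₀
  have hp₀ : 0 < (p₀ : ℝ) := by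
    by_contra! hneg
    nlinarith
  have hp₀' : 0 < p₀ := by exact_mod_cast hp₀
  have hM0 : 0 < M := mul_pos hP0 hp₀'
  have hMle : (M : ℝ) ≤ v ^ E := by
    have h1 : (p₀ : ℝ) * w ≤ 2 * k₀ := by linarith
    calc (M : ℝ) = P * (p₀ * w) * v := by
          rw [hM]; push_cast; linear_combination -(P : ℝ) * p₀ * hvw
      _ ≤ P * (2 * k₀) * v := by gcongr
      _ = 2 * (k₀ * P) * v := by ring
      _ ≤ v * v ^ (2 * d + 2) * v := by gcongr
      _ = v ^ E := by rw [hE]; ring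
  have eM : ((M.toNat : ℕ) : ℝ) = (M : ℝ) := by
    exact_mod_cast congrArg (Int.cast : ℤ → ℝ) (Int.toNat_of_nonneg hM0.le)
  have key := H M.toNat (by omega) ((1 + R) * (v ^ E * w ^ (2 + E + n * E))) (fun i => by
    obtain ⟨c, hc⟩ := Finset.dvd_prod_of_mem k (Finset.mem_univ i)
    rw [← hP] at hc
    have hcR : (P : ℝ) = k i * c := by rw [hc]; push_cast; rfl
    have hki : (1 : ℝ) ≤ k i := by exact_mod_cast hk i
    have hc0 : (0 : ℝ) < c := by
      by_contra! hneg
      nlinarith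
    have hcP : (c : ℝ) ≤ P := by rw [hcR]; nlinarith
    refine ⟨k₀ * c * p i, ?_⟩
    rw [eM]
    have hid : (M : ℝ) * α i - ((k₀ * c * p i : ℤ) : ℝ) =
        v * (k₀ * c * (k i * α i - p i * w) - P * (k₀ - p₀ * w) * α i) := by
      rw [hM]
      push_cast
      rw [hcR]
      linear_combination (-(k₀ * c * p i : ℝ) + k i * c * p₀ * α i) * (-hvw)
    rw [hid, abs_mul, abs_of_pos (by linarith : 0 < v)]
    have hαi : |α i| ≤ R := Finset.single_le_sum (f := fun i => |α i|)
      (fun _ _ => abs_nonneg _) (Finset.mem_univ i)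
    have h1 : |(k₀ : ℝ) * c * (k i * α i - p i * w) - P * (k₀ - p₀ * w) * α i| ≤
        (k₀ * P) * w ^ (2 + E + n * E) * (1 + R) := by
      refine (abs_sub _ _).trans ?_
      rw [abs_mul (k₀ * c : ℝ), abs_mul _ (α i), abs_mul (P : ℝ),
        abs_of_pos (by positivity : (0 : ℝ) < k₀ * c), abs_of_pos hPR]
      have h2 : (k₀ : ℝ) * c * |k i * α i - p i * w| ≤ k₀ * P * w ^ (2 + E + n * E) := by
        gcongr
        exact (hi i).le
      have h3 : (P : ℝ) * |k₀ - p₀ * w| * |α i| ≤ (k₀ * P) * w ^ (2 + E + n * E) * R := by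
        gcongr
        · nlinarith
        · exact (abs_lt.2 h₀).le
      linarith
    calc v * |(k₀ : ℝ) * c * (k i * α i - p i * w) - P * (k₀ - p₀ * w) * α i|
        ≤ v * (v ^ (2 * d + 2) * w ^ (2 + E + n * E) * (1 + R)) := by
          gcongr
          exact h1.trans (by gcongr)
      _ = v ^ (2 * d + 3) * (w ^ (2 + E + n * E) * (1 + R)) := by ring
      _ ≤ v ^ E * (w ^ (2 + E + n * E) * (1 + R)) := by
          gcongr
          · linarith
          · omega
      _ = _ := by ring) (by positivity)
  rw [eM] at key
  have h4 : (1 + R) * (v ^ E * w ^ (2 + E + n * E)) * (M : ℝ) ^ n ≤ (1 + R) * w := by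
    have hMR : (0 : ℝ) < M := by exact_mod_cast hM0
    calc (1 + R) * (v ^ E * w ^ (2 + E + n * E)) * (M : ℝ) ^ n
        ≤ (1 + R) * (v ^ E * w ^ (2 + E + n * E)) * (v ^ E) ^ n := by gcongr
      _ = (1 + R) * (w ^ 2 * (v * w) ^ (E + n * E)) := by
          rw [mul_pow, ← pow_mul]; ring
      _ = (1 + R) * w ^ 2 := by rw [hvw, one_pow, mul_one]
      _ ≤ _ := by gcongr; nlinarith
  linarith

/-- Euclidean division of `e` by `w`, followed by a Dirichlet approximation of the remainder. -/
lemma exists_dirichlet_reduction {w : ℝ} (hw : 0 < w) (hw1 : w ≤ 1 / 2) (e : ℝ) :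
    ∃ a k j : ℤ, 0 ≤ e - a * w ∧ e - a * w < w ∧ 0 < k ∧ k * w ≤ 2 ∧ |(j : ℝ)| * w ≤ 3 ∧
      |k * (e - a * w) - j * w| ≤ w ^ 2 := by
  have hn : 0 < ⌈1 / w⌉₊ := Nat.ceil_pos.2 (by positivity)
  set y := e - ⌊e / w⌋ * w with hy
  have hy0 : 0 ≤ y := by
    have := Int.floor_le (e / w)
    rw [le_div_iff₀ hw] at this
    linarith
  have hyw : y < w := by
    have := Int.lt_floor_add_one (e / w)
    rw [div_lt_iff₀ hw] at this
    linarith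
  obtain ⟨j, k, hk, hkn, hjk⟩ := Real.exists_int_int_abs_mul_sub_le (y / w) hn
  have hkR : (k : ℝ) ≤ ⌈1 / w⌉₊ := by exact_mod_cast hkn
  have hkw : (k : ℝ) * w ≤ 1 + w := by
    have h1 : (k : ℝ) ≤ 1 / w + 1 := hkR.trans (Nat.ceil_lt_add_one (by positivity)).le
    calc (k : ℝ) * w ≤ (1 / w + 1) * w := by gcongr
      _ = _ := by field_simp
  have hk1 : (1 : ℝ) ≤ k := by exact_mod_cast hk
  have hx : |k * y - j * w| ≤ w ^ 2 := by
    have h1 : k * y - j * w = w * (k * (y / w) - j) := by field_simp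
    have h2 : 1 / ((⌈1 / w⌉₊ : ℝ) + 1) ≤ w := by
      rw [div_le_iff₀ (by positivity)]
      have := Nat.le_ceil (1 / w)
      rw [div_le_iff₀ hw] at this
      nlinarith
    rw [h1, abs_mul, abs_of_pos hw, sq]
    gcongr
    exact hjk.trans h2
  refine ⟨⌊e / w⌋, k, j, hy0, hyw, hk, by linarith, ?_, hx⟩
  have h3 : |(j : ℝ) * w| ≤ |k * y - j * w| + |k * y| := by
    rw [abs_sub_comm]
    have := abs_add_le (j * w - k * y) (k * y)
    simpa using this
  rw [abs_mul, abs_of_pos hw, abs_of_nonneg (by positivity : 0 ≤ k * y)] at h3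
  have h4 : k * y ≤ k * w := by gcongr
  nlinarith

/-- From a small time `w` a much smaller one, but not smaller than a fixed power of `w`, is reached
by reducing one of the generators `e` modulo `w` and forming a combination of `w` and the remainder
with coefficients of size `O(1 / w)`. -/
lemma SimultaneouslyDiophantine.exists_reduction {d : ℕ} {α : Fin d → ℝ}
    (hα : SimultaneouslyDiophantine α) : ∃ B : ℕ, ∃ w₀ : ℝ, 0 < w₀ ∧ w₀ ≤ 1 / 2 ∧
      ∀ w : ℝ, 0 < w → w ≤ w₀ → ∃ e ∈ insert 1 (range α), ∃ a k j : ℤ,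
        0 ≤ e - a * w ∧ e - a * w < w ∧ 0 < k ∧ k * w ≤ 2 ∧ |(j : ℝ)| * w ≤ 3 ∧
        |k * (e - a * w) - j * w| ≤ w ^ 2 ∧ w ^ B ≤ |k * (e - a * w) - j * w| := by
  obtain ⟨B, w₀, hw₀, hw₀2, H⟩ := hα.not_almost_commensurable
  refine ⟨B, w₀, hw₀, hw₀2, fun w hw hww => ?_⟩
  have hred := exists_dirichlet_reduction hw (hww.trans hw₀2)
  choose a k j h1 h2 h3 h4 h5 h6 using hred
  by_contra! hno
  have hsmall : ∀ e ∈ insert 1 (range α), |k e * e - (k e * a e + j e : ℤ) * w| < w ^ B := by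
    intro e he
    have := hno e he (a e) (k e) (j e) (h1 e) (h2 e) (h3 e) (h4 e) (h5 e) (h6 e)
    rwa [show (k e : ℝ) * e - (k e * a e + j e : ℤ) * w = k e * (e - a e * w) - j e * w by
      push_cast; ring]
  exact H w hw hww (k 1) (k 1 * a 1 + j 1) (fun i => k (α i))
    (fun i => k (α i) * a (α i) + j (α i)) (h3 1) (h4 1) (fun i => h3 _) (fun i => h4 _)
    (by simpa using hsmall 1 (mem_insert _ _))
    (fun i => hsmall (α i) (mem_insert_of_mem _ (mem_range_self i)))

/-! ### Small times with controlled derivatives -/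

lemma exists_root_of_one_le {v : ℝ} (hv : 1 ≤ v) {n : ℕ} (hn : n ≠ 0) :
    ∃ μ : ℝ, 1 ≤ μ ∧ μ ^ n = v :=
  ⟨v ^ (n⁻¹ : ℝ), Real.one_le_rpow hv (by positivity),
    Real.rpow_inv_natCast_pow (by linarith) hn⟩

namespace SmoothTimes

variable {u : ℝ → ℝ} {f : ℝ → ℝ → ℝ} {d : ℕ} {α : Fin d → ℝ}

/-- The maps at the time obtained from `w` by the reduction of
`SimultaneouslyDiophantine.exists_reduction` lose only a factor `O(w⁻²)`, for an exponent that does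
not depend on the order of differentiation. -/
lemma exists_reduction_bound (h : SmoothTimes u f (integerSpanSubgroup α)) (r : ℕ) :
    ∃ C : ℝ, 1 ≤ C ∧ ∀ w ∈ integerSpanSubgroup α, 0 < w → w ≤ 1 / 2 →
      ∀ e ∈ insert 1 (range α), ∀ a k j : ℤ, 0 ≤ e - a * w → e - a * w < w → 0 < k →
        k * w ≤ 2 → |(j : ℝ)| * w ≤ 3 →
        1 + symSize f r (k * (e - a * w) - j * w) ≤ C * w⁻¹ ^ 2 * (1 + symSize f r w) := by
  set G := integerSpanSubgroup α with hG
  obtain ⟨R, hR⟩ : ∃ R : ℝ, R = 1 + ∑ i, |α i| := ⟨_, rfl⟩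
  have hR1 : 1 ≤ R :=
    hR ▸ le_add_of_nonneg_right (Finset.sum_nonneg fun _ _ => abs_nonneg _)
  obtain ⟨E, hE⟩ : ∃ E : ℝ,
      E = 1 + symSize f r 0 + symSize f r 1 + ∑ i, symSize f r (α i) := ⟨_, rfl⟩
  have hS0 := symSize_nonneg f r 0
  have hS1 := symSize_nonneg f r 1
  have hSα : 0 ≤ ∑ i, symSize f r (α i) := Finset.sum_nonneg fun _ _ => symSize_nonneg _ _ _
  obtain ⟨C, hC, H⟩ := h.exists_symSize_bound r (R + 3)
  set c₁ : ℝ := C * (E + (R + 1)) with hc₁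
  have hE1 : 1 ≤ E := by rw [hE]; linarith
  have hc₁0 : 0 ≤ c₁ := by positivity
  set c₂ : ℝ := C * (E + 2 * c₁) with hc₂
  have hc₂0 : 0 ≤ c₂ := by positivity
  refine ⟨C * (c₂ + 3), by nlinarith, fun w hw hw0 hw2 e he a k j ha0 ha1 hk hkw hjw => ?_⟩
  have heR : |e| ≤ R ∧ e ∈ G ∧ 1 + symSize f r e ≤ E := by
    rcases he with rfl | ⟨i, rfl⟩
    · refine ⟨(abs_one (α := ℝ)).trans_le hR1, one_mem_integerSpan α, by rw [hE]; linarith⟩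
    · refine ⟨?_, generator_mem_integerSpan α i, ?_⟩
      · have := Finset.single_le_sum (f := fun i => |α i|) (fun _ _ => abs_nonneg _)
          (Finset.mem_univ i)
        linarith
      · have := Finset.single_le_sum (f := fun i => symSize f r (α i))
          (fun _ _ => symSize_nonneg _ _ _) (Finset.mem_univ i)
        rw [hE]
        linarith
  obtain ⟨heR, heG, heE⟩ := heR
  set v : ℝ := w⁻¹ with hv
  have hvw : v * w = 1 := inv_mul_cancel₀ hw0.ne'
  have hv1 : 1 ≤ v := by rw [hv, one_le_inv₀ hw0]; linarith
  set Z : ℝ := 1 + symSize f r w with hZ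
  have hSw : symSize f r w ≤ Z := by rw [hZ]; linarith
  have hSw0 := symSize_nonneg f r w
  have hZ1 : 1 ≤ Z := by rw [hZ]; linarith
  have hle : ∀ b B : ℝ, b * w ≤ B → b ≤ B * v := by
    intro b B hb
    calc b = b * w * v := by linear_combination -b * hvw
      _ ≤ _ := by gcongr
  have hvZ : 1 ≤ v * Z := one_le_mul_of_one_le_of_one_le hv1 hZ1
  have hv2Z : v * Z ≤ v ^ 2 * Z := by nlinarith
  have haw : |(a : ℝ)| * w ≤ R + 1 := by
    have h1 : |(a : ℝ)| * w = |a * w| := by rw [abs_mul, abs_of_pos hw0]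
    have h2 : |a * w| ≤ |e| + |e - a * w| := by
      rw [abs_sub_comm]
      have := abs_add_le e (a * w - e)
      simpa using this
    rw [abs_of_nonneg ha0] at h2
    linarith
  have hyG : e - a * w ∈ G := by
    rw [← zsmul_eq_mul]
    exact G.sub_mem heG (G.zsmul_mem hw a)
  have hy : 1 + symSize f r (e - a * w) ≤ c₁ * (v * Z) := by
    have h1 := H e heG w hw (-a) (by linarith) (by
      rw [Int.cast_neg, abs_neg, abs_of_pos hw0]; linarith)
    rw [Int.cast_neg, abs_neg, neg_mul, ← sub_eq_add_neg] at h1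
    refine h1.trans ?_
    rw [hc₁, mul_assoc]
    gcongr
    have h2 : |(a : ℝ)| * symSize f r w ≤ (R + 1) * v * Z := by gcongr; exact hle _ _ haw
    have h3 : E ≤ E * (v * Z) := le_mul_of_one_le_right (by linarith) hvZ
    linarith
  have hkR : (0 : ℝ) < k := by exact_mod_cast hk
  have hkG : k * (e - a * w) ∈ G := by
    rw [← zsmul_eq_mul]
    exact G.zsmul_mem hyG k
  have hky : k * (e - a * w) ≤ 2 := by
    have : k * (e - a * w) ≤ k * w := by gcongr
    linarith
  have hx : 1 + symSize f r (k * (e - a * w)) ≤ c₂ * (v ^ 2 * Z) := by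
    have h1 := H 0 G.zero_mem _ hyG k (by rw [abs_zero]; linarith) (by
      rw [abs_of_pos hkR, abs_of_nonneg ha0]; linarith)
    rw [zero_add, abs_of_pos hkR] at h1
    refine h1.trans ?_
    rw [hc₂, mul_assoc]
    gcongr
    have h2 : k * symSize f r (e - a * w) ≤ (2 * v) * (c₁ * (v * Z)) := by
      gcongr
      · exact symSize_nonneg _ _ _
      · exact hle _ _ hkw
      · linarith
    have h3 : E ≤ E * (v ^ 2 * Z) := le_mul_of_one_le_right (by linarith) (hvZ.trans hv2Z)
    have h4 : 1 + symSize f r 0 ≤ E := by rw [hE]; linarith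
    linarith
  have h1 := H _ hkG w hw (-j) (by
    rw [abs_of_nonneg (by positivity)]; linarith) (by
    rw [Int.cast_neg, abs_neg, abs_of_pos hw0]; linarith)
  rw [Int.cast_neg, abs_neg, neg_mul, ← sub_eq_add_neg] at h1
  refine h1.trans ?_
  rw [mul_assoc, mul_assoc]
  gcongr
  have h2 : |(j : ℝ)| * symSize f r w ≤ 3 * v * Z := by gcongr; exact hle _ _ hjw
  linarith

/-- There are times `w k` in the group, decreasing to `0` super-exponentially fast but in a
controlled way, whose maps have derivatives of size at most `O((w k)⁻⁴)` at all orders. -/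
lemma exists_times (h : SmoothTimes u f (integerSpanSubgroup α))
    (hα : SimultaneouslyDiophantine α) : ∃ B : ℕ, ∃ w : ℕ → ℝ,
      (∀ k, w k ∈ integerSpanSubgroup α ∧ 0 < w k ∧ w k ≤ 1 / 2 ∧ w k ^ B ≤ w (k + 1) ∧
        w (k + 1) ≤ w k ^ 2) ∧
      ∀ r, ∃ D : ℝ, 0 ≤ D ∧ ∀ k, symSize f r (w k) ≤ D * (w k)⁻¹ ^ 4 := by
  obtain ⟨B, w₀, hw₀, hw₀2, hred⟩ := hα.exists_reduction
  have hbd := fun r => h.exists_reduction_bound r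
  choose C hC H using hbd
  obtain ⟨t₀, ht₀G, ht₀, ht₀w⟩ := hα.exists_small_mem hw₀
  have hstep : ∀ w : {w : ℝ // w ∈ integerSpanSubgroup α ∧ 0 < w ∧ w ≤ w₀},
      ∃ w' : {w : ℝ // w ∈ integerSpanSubgroup α ∧ 0 < w ∧ w ≤ w₀},
        w.1 ^ B ≤ w'.1 ∧ w'.1 ≤ w.1 ^ 2 ∧
        ∀ r, 1 + symSize f r w' ≤ C r * (w.1)⁻¹ ^ 2 * (1 + symSize f r w) := by
    rintro ⟨w, hwG, hw0, hww⟩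
    obtain ⟨e, he, a, k, j, h1, h2, h3, h4, h5, h6, h7⟩ := hred w hw0 hww
    have heG : e ∈ integerSpanSubgroup α := by
      rcases he with rfl | ⟨i, rfl⟩
      exacts [one_mem_integerSpan α, generator_mem_integerSpan α i]
    have hxG : k * (e - a * w) - j * w ∈ integerSpanSubgroup α := by
      rw [← zsmul_eq_mul, ← zsmul_eq_mul, ← zsmul_eq_mul]
      exact AddSubgroup.sub_mem _ (AddSubgroup.zsmul_mem _ (AddSubgroup.sub_mem _ heG
        (AddSubgroup.zsmul_mem _ hwG _)) _) (AddSubgroup.zsmul_mem _ hwG _)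
    refine ⟨⟨|k * (e - a * w) - j * w|, ?_, (pow_pos hw0 B).trans_le h7,
      h6.trans (by nlinarith)⟩, h7, h6, fun r => ?_⟩
    · rcases abs_choice (k * (e - a * w) - j * w) with h | h <;> rw [h]
      exacts [hxG, AddSubgroup.neg_mem _ hxG]
    · simp only [symSize_abs]
      exact H r w hwG hw0 (hww.trans hw₀2) e he a k j h1 h2 h3 h4 h5
  choose nxt hnxt1 hnxt2 hnxt3 using hstep
  set W : ℕ → {w : ℝ // w ∈ integerSpanSubgroup α ∧ 0 < w ∧ w ≤ w₀} :=
    fun k => nxt^[k] ⟨t₀, ht₀G, ht₀, ht₀w⟩ with hW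
  have hWs : ∀ k, W (k + 1) = nxt (W k) := fun k => Function.iterate_succ_apply' _ _ _
  have hprop : ∀ k, (W k).1 ∈ integerSpanSubgroup α ∧ 0 < (W k).1 ∧ (W k).1 ≤ 1 / 2 ∧
      (W k).1 ^ B ≤ (W (k + 1)).1 ∧ (W (k + 1)).1 ≤ (W k).1 ^ 2 := fun k => by
    refine ⟨(W k).2.1, (W k).2.2.1, (W k).2.2.2.trans hw₀2, ?_, ?_⟩ <;> rw [hWs]
    exacts [hnxt1 _, hnxt2 _]
  refine ⟨B, fun k => (W k).1, hprop, fun r => ?_⟩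
  have hv2 : ∀ k, 2 ≤ ((W k).1)⁻¹ := fun k => by
    rw [le_inv_comm₀ (by norm_num) (hprop k).2.1]
    linarith [(hprop k).2.2.1]
  have hvs : ∀ k, ((W k).1)⁻¹ ^ 2 ≤ ((W (k + 1)).1)⁻¹ := fun k => by
    rw [inv_pow]
    exact inv_anti₀ (hprop (k + 1)).2.1 (hprop k).2.2.2.2
  have hvk : ∀ k : ℕ, (k : ℝ) ≤ ((W k).1)⁻¹ := by
    intro k
    induction k with
    | zero => have := hv2 0; push_cast; linarith
    | succ k ih => have := hv2 k; have := hvs k; push_cast; nlinarith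
  obtain ⟨N, hN⟩ := exists_nat_ge (C r)
  set Z : ℕ → ℝ := fun k => 1 + symSize f r (W k).1 with hZ
  have hZ0 : ∀ k, 0 ≤ Z k := fun k => add_nonneg zero_le_one (symSize_nonneg _ _ _)
  set D : ℝ := ∑ i ∈ Finset.range (N + 1), Z i with hD
  have hD0 : 0 ≤ D := Finset.sum_nonneg fun i _ => hZ0 i
  have key : ∀ k, Z k ≤ D * ((W k).1)⁻¹ ^ 4 := by
    intro k
    induction k with
    | zero =>
      have h1 : Z 0 ≤ D := Finset.single_le_sum (fun i _ => hZ0 i) (by simp)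
      exact h1.trans (le_mul_of_one_le_right hD0 (one_le_pow₀ (by linarith [hv2 0])))
    | succ k ih =>
      rcases Nat.lt_or_ge k N with hk | hk
      · have h1 : Z (k + 1) ≤ D := Finset.single_le_sum (fun i _ => hZ0 i) (by simpa using hk)
        exact h1.trans (le_mul_of_one_le_right hD0 (one_le_pow₀ (by linarith [hv2 (k + 1)])))
      · have h1 : Z (k + 1) ≤ C r * ((W k).1)⁻¹ ^ 2 * Z k := by
          have := hnxt3 (W k) r
          rwa [← hWs] at this
        have h2 : C r ≤ ((W k).1)⁻¹ ^ 2 := by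
          have h3 : (N : ℝ) ≤ k := by exact_mod_cast hk
          nlinarith [hvk k, hv2 k]
        calc Z (k + 1) ≤ C r * ((W k).1)⁻¹ ^ 2 * Z k := h1
          _ ≤ ((W k).1)⁻¹ ^ 2 * ((W k).1)⁻¹ ^ 2 * (D * ((W k).1)⁻¹ ^ 4) := by
              have := hZ0 k
              have := hv2 k
              gcongr
          _ = D * (((W k).1)⁻¹ ^ 2) ^ 4 := by ring
          _ ≤ _ := by gcongr; exact hvs k
  exact ⟨D, hD0, fun k => le_trans (by simp [hZ]) (key k)⟩

/-- Interpolating, at a very high order, the polynomial bounds of `exists_times` with the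
`C⁰` bound `O(w k)` shows that the multiples of `w (k + 1)` up to `w k` have maps that are
`C^r`-close to the identity, for every `r`. -/
lemma exists_close_to_id (h : SmoothTimes u f (integerSpanSubgroup α))
    (hα : SimultaneouslyDiophantine α) : ∃ w : ℕ → ℝ,
      (∀ k, w k ∈ integerSpanSubgroup α ∧ 0 < w k ∧ w k ≤ (1 / 2) ^ k) ∧
      ∀ r, ∃ C : ℝ, 0 ≤ C ∧ ∀ k, ∀ a : ℕ, a * w (k + 1) ≤ w k →
        supDeriv r (displacement f (a * w (k + 1))) ≤ C * (1 / 2) ^ k := by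
  obtain ⟨B, w, hw, hD⟩ := h.exists_times hα
  have hgeo : ∀ k, w k ≤ (1 / 2) ^ (k + 1) := by
    intro k
    induction k with
    | zero => simpa using (hw 0).2.2.1
    | succ k ih =>
      obtain ⟨-, h1, h2, -, h3⟩ := hw k
      calc w (k + 1) ≤ w k ^ 2 := h3
        _ ≤ w k * (1 / 2) := by rw [sq]; gcongr
        _ ≤ (1 / 2) ^ (k + 1) * (1 / 2) := by gcongr
        _ = _ := by ring
  refine ⟨w, fun k => ⟨(hw k).1, (hw k).2.1, (hgeo k).trans
    (pow_le_pow_of_le_one (by norm_num) (by norm_num) (by omega))⟩, fun r => ?_⟩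
  -- the order `n` is so large that `w * μ ^ n` dominates the losses while `w * μ ^ r ≤ √w`
  set n : ℕ := 2 * (r + 1) * (5 * B + 1) with hn
  obtain ⟨D, hD0, hDk⟩ := hD n
  obtain ⟨C₁, hC₁, hiter⟩ := h.exists_iterate_bound n 1
  obtain ⟨C₂, hC₂, hint⟩ := exists_interpolation n
  obtain ⟨C₃, hC₃, hC1⟩ := h.flow.exists_C1_bound h.contDiff_field h.periodic 1
  set N₀ := supDeriv n (displacement f 0) with hN₀
  have hN₀0 : 0 ≤ N₀ := supDeriv_nonneg _ _
  set A : ℝ := C₃ + C₁ * (1 + N₀ + D) with hA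
  have hA0 : 0 ≤ A := by positivity
  refine ⟨2 * (C₂ * A), by positivity, fun k a ha => ?_⟩
  obtain ⟨hkG, hk0, hk2, hkB, hks⟩ := hw k
  obtain ⟨hkG', hk0', hk2', -, -⟩ := hw (k + 1)
  set v : ℝ := (w k)⁻¹ with hv
  have hvw : w k * v = 1 := mul_inv_cancel₀ hk0.ne'
  have hv1 : 1 ≤ v := by rw [hv, one_le_inv₀ hk0]; linarith
  set v' : ℝ := (w (k + 1))⁻¹ with hv'
  have hvw' : w (k + 1) * v' = 1 := mul_inv_cancel₀ hk0'.ne'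
  have hv1' : 1 ≤ v' := by rw [hv', one_le_inv₀ hk0']; linarith
  have hvB : v' ≤ v ^ B := by
    rw [hv, inv_pow]
    exact inv_anti₀ (by positivity) hkB
  have htG : a * w (k + 1) ∈ integerSpanSubgroup α := by
    rw [← nsmul_eq_mul]
    exact AddSubgroup.nsmul_mem _ hkG' a
  have ht0 : 0 ≤ a * w (k + 1) := by positivity
  have hav : (a : ℝ) ≤ v' := by
    have h1 : (a : ℝ) = a * w (k + 1) * v' := by linear_combination -(a : ℝ) * hvw'
    rw [h1]
    exact mul_le_of_le_one_left (by linarith) (by linarith)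
  have htop : supDeriv n (displacement f (a * w (k + 1))) ≤ C₁ * (1 + N₀ + D) * v ^ (5 * B) := by
    have h1 := hiter 0 (AddSubgroup.zero_mem _) _ hkG' a (by simp) (by
      rw [abs_of_pos hk0']; linarith)
    rw [zero_add, ← hN₀] at h1
    have h2 : a * supDeriv n (displacement f (w (k + 1))) ≤ v' * (D * v' ^ 4) := by
      gcongr
      · exact supDeriv_nonneg _ _
      · exact (supDeriv_le_symSize _ _ _).trans (hDk (k + 1))
    have h3 : 1 ≤ v' ^ 5 := one_le_pow₀ hv1'
    calc supDeriv n (displacement f (a * w (k + 1)))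
        ≤ C₁ * (1 + N₀ + a * supDeriv n (displacement f (w (k + 1)))) := by linarith
      _ ≤ C₁ * ((1 + N₀) * v' ^ 5 + D * v' ^ 5) := by
          refine mul_le_mul_of_nonneg_left (add_le_add ?_ ?_) (by positivity)
          · exact le_mul_of_one_le_right (by positivity) h3
          · exact h2.trans_eq (by ring)
      _ = C₁ * (1 + N₀ + D) * v' ^ 5 := by ring
      _ ≤ C₁ * (1 + N₀ + D) * (v ^ B) ^ 5 := by gcongr
      _ = _ := by rw [← pow_mul, mul_comm B]
  obtain ⟨μ, hμ1, hμ⟩ := exists_root_of_one_le hv1 (n := 2 * (r + 1)) (by omega)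
  have hlow := (hC1 (a * w (k + 1)) (by rw [abs_of_nonneg ht0]; linarith)).1
  rw [abs_of_nonneg ht0] at hlow
  have key := hint _ (h.smoothBounded htG) (A * w k) μ (by linarith) (by
    refine hlow.trans ?_
    have : C₃ ≤ A := by rw [hA]; exact le_add_of_nonneg_right (by positivity)
    gcongr) (by
    refine htop.trans ?_
    have e : A * w k * μ ^ n = A * v ^ (5 * B) := by
      rw [hn, pow_mul, hμ, pow_succ]
      linear_combination A * v ^ (5 * B) * hvw
    rw [e]
    gcongr
    rw [hA]
    linarith) r (by rw [hn]; nlinarith)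
  have hsqrt : w k * μ ^ r ≤ √(w k) := by
    have h1 : μ ^ (r + 1) = √v := by
      rw [eq_comm, Real.sqrt_eq_iff_mul_self_eq (by linarith) (by positivity), ← hμ]
      ring
    calc w k * μ ^ r ≤ w k * μ ^ (r + 1) := by
          have := pow_le_pow_right₀ hμ1 (Nat.le_succ r)
          gcongr
      _ = w k / √(w k) := by rw [h1, hv, Real.sqrt_inv, div_eq_mul_inv]
      _ = _ := Real.div_sqrt
  have hsq2 : √(w k) ≤ 2 * (1 / 2) ^ k := by
    rcases k with _ | k
    · rw [Real.sqrt_le_left (by norm_num)]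
      norm_num
      linarith
    · rw [Real.sqrt_le_left (by positivity)]
      refine (hw k).2.2.2.2.trans ?_
      have := hgeo k
      have h0 := (hw k).2.1
      gcongr
      exact this.trans (le_mul_of_one_le_left (by positivity) (by norm_num))
  calc supDeriv r (displacement f (a * w (k + 1))) ≤ C₂ * (A * w k) * μ ^ r := key
    _ = C₂ * A * (w k * μ ^ r) := by ring
    _ ≤ C₂ * A * (2 * (1 / 2) ^ k) := mul_le_mul_of_nonneg_left (hsqrt.trans hsq2) (by positivity)
    _ = _ := by ring

end SmoothTimes

/-! ### Greedy expansions and passage to the limit -/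

/-- The greedy expansion of `x` from below along the times `w`. -/
noncomputable def greedySum (w : ℕ → ℝ) (x : ℝ) : ℕ → ℝ
  | 0 => ⌊x / w 0⌋₊ * w 0
  | k + 1 => greedySum w x k + ⌊(x - greedySum w x k) / w (k + 1)⌋₊ * w (k + 1)

lemma natFloor_div_mul_le {y w : ℝ} (hw : 0 < w) (hy : 0 ≤ y) :
    ⌊y / w⌋₊ * w ≤ y ∧ y < ⌊y / w⌋₊ * w + w := by
  have h1 := Nat.floor_le (by positivity : 0 ≤ y / w)
  have h2 := Nat.lt_floor_add_one (y / w)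
  rw [le_div_iff₀ hw] at h1
  rw [div_lt_iff₀ hw] at h2
  exact ⟨h1, by linarith⟩

lemma greedySum_bounds {w : ℕ → ℝ} (hw : ∀ k, 0 < w k) {x : ℝ} (hx : 0 ≤ x) (k : ℕ) :
    0 ≤ greedySum w x k ∧ greedySum w x k ≤ x ∧ x < greedySum w x k + w k := by
  induction k with
  | zero =>
    obtain ⟨h1, h2⟩ := natFloor_div_mul_le (hw 0) hx
    have := hw 0
    exact ⟨by rw [greedySum]; positivity, h1, h2⟩
  | succ k ih =>
    obtain ⟨h1, h2⟩ := natFloor_div_mul_le (hw (k + 1)) (sub_nonneg.2 ih.2.1)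
    have := hw (k + 1)
    have h3 : 0 ≤ ⌊(x - greedySum w x k) / w (k + 1)⌋₊ * w (k + 1) := by positivity
    rw [greedySum]
    exact ⟨by linarith, by linarith, by linarith⟩

lemma greedySum_mem {w : ℕ → ℝ} {G : AddSubgroup ℝ} (hw : ∀ k, w k ∈ G) (x : ℝ) (k : ℕ) :
    greedySum w x k ∈ G := by
  induction k with
  | zero =>
    rw [greedySum, ← nsmul_eq_mul]
    exact G.nsmul_mem (hw 0) _
  | succ k ih =>
    rw [greedySum, ← nsmul_eq_mul]
    exact G.add_mem ih (G.nsmul_mem (hw _) _)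

lemma tendsto_greedySum {w : ℕ → ℝ} (hw : ∀ k, 0 < w k ∧ w k ≤ (1 / 2) ^ k) {x : ℝ}
    (hx : 0 ≤ x) : Filter.Tendsto (greedySum w x) Filter.atTop (nhds x) := by
  have h1 : Filter.Tendsto (fun k : ℕ => x - (1 / 2 : ℝ) ^ k) Filter.atTop (nhds x) := by
    simpa using tendsto_const_nhds.sub
      (tendsto_pow_atTop_nhds_zero_of_lt_one (by norm_num : (0 : ℝ) ≤ 1 / 2) (by norm_num))
  refine tendsto_of_tendsto_of_tendsto_of_le_of_le h1 tendsto_const_nhds (fun k => ?_) fun k => ?_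
  · have := (greedySum_bounds (fun k => (hw k).1) hx k).2.2
    have := (hw k).2
    simp only
    linarith
  · exact (greedySum_bounds (fun k => (hw k).1) hx k).2.1

lemma le_mul_exp_of_le_mul_one_add {X : ℕ → ℝ} {c : ℝ} (hc : 0 ≤ c)
    (hX0 : 0 ≤ X 0) (hX : ∀ k, X (k + 1) ≤ X k * (1 + c * (1 / 2) ^ k)) (k : ℕ) :
    X k ≤ X 0 * Real.exp (2 * c) := by
  have key : X k ≤ X 0 * Real.exp (c * (2 - 2 * (1 / 2) ^ k)) := by
    induction k with
    | zero => simp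
    | succ k ih =>
      calc X (k + 1) ≤ X k * (1 + c * (1 / 2) ^ k) := hX k
        _ ≤ X 0 * Real.exp (c * (2 - 2 * (1 / 2) ^ k)) * Real.exp (c * (1 / 2) ^ k) := by
            gcongr
            linarith [Real.add_one_le_exp (c * (1 / 2) ^ k)]
        _ = _ := by
            rw [mul_assoc, ← Real.exp_add]
            congr 2
            rw [pow_succ]
            ring
  have h1 : (0 : ℝ) ≤ (1 / 2) ^ k := by positivity
  exact key.trans (mul_le_mul_of_nonneg_left (Real.exp_le_exp.2 (by nlinarith)) hX0)

namespace SmoothTimes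

variable {u : ℝ → ℝ} {f : ℝ → ℝ → ℝ} {G : AddSubgroup ℝ} {w : ℕ → ℝ}

/-- Along a greedy expansion the derivatives of the maps stay bounded and their increments decay
geometrically, uniformly in the expanded time. -/
lemma exists_greedySum_bound (h : SmoothTimes u f G)
    (hw : ∀ k, w k ∈ G ∧ 0 < w k ∧ w k ≤ (1 / 2) ^ k) (r : ℕ)
    (hclose : ∃ C : ℝ, 0 ≤ C ∧ ∀ k, ∀ a : ℕ, a * w (k + 1) ≤ w k →
        supDeriv r (displacement f (a * w (k + 1))) ≤ C * (1 / 2) ^ k) :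
    ∃ M : ℝ, 0 ≤ M ∧ ∀ x ∈ Icc (0 : ℝ) 1, ∀ k,
      supDeriv r (displacement f (greedySum w x k)) ≤ M ∧
      ∀ y, |iteratedDeriv r (displacement f (greedySum w x (k + 1) - greedySum w x k) ∘
        f (greedySum w x k)) y| ≤ M * (1 / 2) ^ k := by
  obtain ⟨C, hC, hcl⟩ := hclose
  obtain ⟨C₁, hC₁, hinc⟩ := h.exists_increment_bound r 1
  obtain ⟨C₂, hC₂, hiter⟩ := h.exists_iterate_bound r 1
  set N₀ := supDeriv r (displacement f 0) with hN₀
  set N₁ := supDeriv r (displacement f (w 0)) with hN₁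
  have hN₀0 : 0 ≤ N₀ := supDeriv_nonneg _ _
  have hN₁0 : 0 ≤ N₁ := supDeriv_nonneg _ _
  have hw0 := (hw 0).2.1
  set c : ℝ := C₁ * (1 + C) with hc
  have hc0 : 0 ≤ c := by positivity
  set M₀ : ℝ := C₂ * (1 + N₀ + (w 0)⁻¹ * N₁) * Real.exp (2 * c) with hM₀
  have hM₀0 : 0 ≤ M₀ := by positivity
  refine ⟨M₀ + c * M₀, by positivity, fun x hx => ?_⟩
  have hb := greedySum_bounds (fun k => (hw k).2.1) hx.1
  have hG := greedySum_mem (fun k => (hw k).1) x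
  set t := greedySum w x with ht
  set X : ℕ → ℝ := fun k => 1 + supDeriv r (displacement f (t k)) with hX
  have hX1 : ∀ k, 1 ≤ X k := fun k => le_add_of_nonneg_right (supDeriv_nonneg _ _)
  have ht1 : ∀ k, |t k| ≤ 1 := fun k => by
    rw [abs_of_nonneg (hb k).1]
    exact (hb k).2.1.trans hx.2
  have hincr : ∀ k y, |iteratedDeriv r (displacement f (t (k + 1) - t k) ∘ f (t k)) y| ≤
      c * (1 / 2) ^ k * X k := by
    intro k y
    obtain ⟨a, ha⟩ : ∃ a : ℕ, t (k + 1) - t k = a * w (k + 1) :=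
      ⟨_, by rw [ht, greedySum]; exact add_sub_cancel_left _ _⟩
    have h0 : 0 ≤ a * w (k + 1) := mul_nonneg (by positivity) (hw _).2.1.le
    have h1 : a * w (k + 1) ≤ w k := by
      have := (hb k).2.2
      have := (hb (k + 1)).2.1
      linarith
    have h2 := (hw k).2.2
    have h3 : ((1 : ℝ) / 2) ^ k ≤ 1 := pow_le_one₀ (by norm_num) (by norm_num)
    have := hinc (t k) (hG k) (t (k + 1) - t k) (G.sub_mem (hG _) (hG _)) (ht1 k)
      (by rw [ha, abs_of_nonneg h0]; linarith) ((1 / 2) ^ k) (C * (1 / 2) ^ k) (by positivity)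
      (by rw [ha, abs_of_nonneg h0]; linarith) (by positivity) (by rw [ha]; exact hcl k a h1) y
    refine this.trans ?_
    have h4 : C₁ * (1 / 2) ^ k * C * 1 ≤ C₁ * (1 / 2) ^ k * C * X k := by
      gcongr
      exact hX1 k
    calc C₁ * ((1 / 2) ^ k * X k + C * (1 / 2) ^ k)
        = C₁ * (1 / 2) ^ k * X k + C₁ * (1 / 2) ^ k * C * 1 := by ring
      _ ≤ C₁ * (1 / 2) ^ k * X k + C₁ * (1 / 2) ^ k * C * X k := by linarith
      _ = _ := by rw [hc]; ring
  have hXs : ∀ k, X (k + 1) ≤ X k * (1 + c * (1 / 2) ^ k) := by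
    intro k
    have := h.supDeriv_add_le r (hG k) (G.sub_mem (hG (k + 1)) (hG k)) (hincr k)
    rw [add_sub_cancel] at this
    simp only [hX] at this ⊢
    linarith
  have hX0 : X 0 ≤ C₂ * (1 + N₀ + (w 0)⁻¹ * N₁) := by
    have h1 : (⌊x / w 0⌋₊ : ℝ) * w 0 ≤ 1 := (hb 0).2.1.trans hx.2
    have h2 := hiter 0 G.zero_mem (w 0) (hw 0).1 ⌊x / w 0⌋₊ (by simp)
      (by rwa [abs_of_pos hw0])
    rw [zero_add] at h2
    refine h2.trans ?_
    gcongr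
    rw [← one_div, le_div_iff₀ hw0]
    exact h1
  have hXM : ∀ k, X k ≤ M₀ := fun k =>
    (le_mul_exp_of_le_mul_one_add hc0 (zero_le_one.trans (hX1 0)) hXs k).trans
      (mul_le_mul_of_nonneg_right hX0 (Real.exp_pos _).le)
  refine fun k => ⟨?_, fun y => (hincr k y).trans ?_⟩
  · have h1 := hXM k
    have h2 : 0 ≤ c * M₀ := by positivity
    simp only [hX] at h1
    linarith
  · calc c * (1 / 2) ^ k * X k ≤ c * (1 / 2) ^ k * M₀ := by gcongr; exact hXM k
      _ = c * M₀ * (1 / 2) ^ k := by ring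
      _ ≤ _ := by gcongr; linarith

/-- Passing to the limit along greedy expansions: all time-`x` maps with `0 ≤ x ≤ 1` are smooth,
with uniformly bounded derivatives at each order. -/
lemma exists_uniform_bound (h : SmoothTimes u f G)
    (hw : ∀ k, w k ∈ G ∧ 0 < w k ∧ w k ≤ (1 / 2) ^ k)
    (hclose : ∀ r, ∃ C : ℝ, 0 ≤ C ∧ ∀ k, ∀ a : ℕ, a * w (k + 1) ≤ w k →
        supDeriv r (displacement f (a * w (k + 1))) ≤ C * (1 / 2) ^ k) :
    (∀ x ∈ Icc (0 : ℝ) 1, ContDiff ℝ ∞ (f x)) ∧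
    ∀ r, ∃ M : ℝ, ∀ x ∈ Icc (0 : ℝ) 1, ∀ y, |iteratedDeriv r (displacement f x) y| ≤ M := by
  have hbd := fun r => h.exists_greedySum_bound hw r (hclose r)
  choose M hM0 hM using hbd
  obtain ⟨K, hL, -⟩ := exists_bound_of_periodic h.contDiff_field h.periodic
  have hgeo : ∀ r : ℕ, HasSum (fun k : ℕ => M r * (1 / 2 : ℝ) ^ k) (M r * 2) := fun r =>
    (hasSum_geometric_two).mul_left (M r)
  have key : ∀ x ∈ Icc (0 : ℝ) 1, ∃ g : ℝ → ℝ, ContDiff ℝ ∞ g ∧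
      (∀ r y, |iteratedDeriv r g y| ≤ M r * 2) ∧
      displacement f x = fun y => displacement f (greedySum w x 0) y + g y := by
    intro x hx
    have hG := greedySum_mem (fun k => (hw k).1) x
    set t := greedySum w x with ht
    set I : ℕ → ℝ → ℝ := fun k => displacement f (t (k + 1) - t k) ∘ f (t k) with hI
    have hIs : ∀ k, ContDiff ℝ ∞ (I k) := fun k =>
      (h.smoothBounded (G.sub_mem (hG (k + 1)) (hG k))).1.comp (h.smooth _ (hG k))
    have hIb : ∀ (r k : ℕ) (y : ℝ), ((r : ℕ∞) ≤ (⊤ : ℕ∞)) →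
        ‖iteratedFDeriv ℝ r (I k) y‖ ≤ M r * (1 / 2) ^ k := fun r k y _ => by
      rw [norm_iteratedFDeriv_eq_norm_iteratedDeriv]
      exact (hM r x hx k).2 y
    refine ⟨fun y => ∑' k, I k y, ?_, fun r y => ?_, ?_⟩
    · exact contDiff_tsum hIs (fun r _ => (hgeo r).summable) hIb
    · rw [← Real.norm_eq_abs, ← norm_iteratedFDeriv_eq_norm_iteratedDeriv,
        iteratedFDeriv_tsum_apply hIs (fun r _ => (hgeo r).summable) hIb le_top]
      exact tsum_of_norm_bounded (hgeo r) fun k => hIb r k y le_top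
    · funext y
      have hsum : Summable fun k => I k y := Summable.of_norm_bounded (hgeo 0).summable
        fun k => by simpa [hI] using (hM 0 x hx k).2 y
      have hpart : ∀ n, ∑ k ∈ Finset.range n, I k y = f (t n) y - f (t 0) y := by
        intro n
        rw [← Finset.sum_range_sub (fun k => f (t k) y)]
        refine Finset.sum_congr rfl fun k _ => ?_
        simp only [hI, displacement, Function.comp_apply]
        rw [← h.flow.add_apply hL, sub_add_cancel]
      have hlim : Filter.Tendsto (fun n => f (t n) y - f (t 0) y) Filter.atTop
          (nhds (f x y - f (t 0) y)) :=
        ((h.flow.hasDerivAt y x).continuousAt.tendsto.comp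
          (tendsto_greedySum (fun k => (hw k).2) hx.1)).sub_const _
      have huniq := tendsto_nhds_unique hsum.hasSum.tendsto_sum_nat
        (by simpa only [hpart] using hlim)
      simp only [displacement]
      rw [huniq]
      ring
  refine ⟨fun x hx => ?_, fun r => ⟨M r + M r * 2, fun x hx y => ?_⟩⟩
  · obtain ⟨g, hg, -, hgx⟩ := key x hx
    have e : f x = fun y => displacement f (greedySum w x 0) y + g y + y := by
      funext y
      rw [← congrFun hgx y, displacement, sub_add_cancel]
    rw [e]
    exact ((h.smoothBounded (greedySum_mem (fun k => (hw k).1) x 0)).1.add hg).add contDiff_id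
  · obtain ⟨g, hg, hgb, hgx⟩ := key x hx
    have hs := h.smoothBounded (greedySum_mem (fun k => (hw k).1) x 0)
    rw [hgx, iteratedDeriv_fun_add (hs.1.contDiffAt.of_le (by exact_mod_cast le_top))
      (hg.contDiffAt.of_le (by exact_mod_cast le_top))]
    exact (abs_add_le _ _).trans (add_le_add ((hs.abs_le r y).trans (hM r x hx 0).1) (hgb r y))

end SmoothTimes

lemma crBounded_image_of_bound {f : ℝ → ℝ → ℝ} {S : Set ℝ}
    (hsm : ∀ t ∈ S, ContDiff ℝ ∞ (f t))
    (hbd : ∀ r, ∃ M : ℝ, ∀ t ∈ S, ∀ y, |iteratedDeriv r (displacement f t) y| ≤ M) (r : ℕ) :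
    CrBounded r (f '' S) := by
  choose M hM using hbd
  refine ⟨?_, ∑ j ∈ Finset.range (r + 1), (M j).toNNReal, ?_⟩
  · rintro _ ⟨t, ht, rfl⟩
    exact (hsm t ht).of_le (by exact_mod_cast le_top)
  · rintro _ ⟨t, ht, rfl⟩
    refine iSup₂_le fun j hj => iSup_le fun y => ?_
    have h1 : ‖iteratedDeriv j (displacement f t) y‖₊ ≤ (M j).toNNReal := by
      rw [← NNReal.coe_le_coe, coe_nnnorm, Real.norm_eq_abs]
      exact (hM j t ht y).trans (Real.le_coe_toNNReal _)
    have h2 : (M j).toNNReal ≤ ∑ j ∈ Finset.range (r + 1), (M j).toNNReal :=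
      Finset.single_le_sum (f := fun j => (M j).toNNReal) (fun _ _ => zero_le) hj
    rw [enorm_eq_nnnorm]
    exact ENNReal.coe_le_coe.2 (h1.trans h2)

theorem theoremt (d : ℕ) (hd : 1 ≤ d) (α : Fin d → ℝ) (hα : SimultaneouslyDiophantine α)
    (u : ℝ → ℝ) (hu : ContDiff ℝ 1 u) (hper : Function.Periodic u 1)
    (f : ℝ → ℝ → ℝ) (hf : IsFlowOf u f)
    (hsmooth : ∀ t ∈ integerSpan α, ContDiff ℝ ∞ (f t)) :
    (∃ T : Set ℝ, T ⊆ integerSpan α ∧ T ⊆ Icc (0 : ℝ) 1 ∧ Icc (0 : ℝ) 1 ⊆ closure T ∧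
      ∀ r : ℕ, 1 ≤ r → CrBounded (r + 1) (f '' T)) ∧
    ∀ r : ℕ, 1 ≤ r →
      (∀ t : ℝ, ContDiff ℝ r (f t)) ∧ CrBounded r (f '' Icc (0 : ℝ) 1) := by
  have h : SmoothTimes u f (integerSpanSubgroup α) := ⟨hf, hu, hper, hsmooth⟩
  obtain ⟨w, hw, hclose⟩ := h.exists_close_to_id hα
  obtain ⟨hsm, hbd⟩ := h.exists_uniform_bound hw hclose
  obtain ⟨K, hL, -⟩ := exists_bound_of_periodic hu hper
  set T : Set ℝ := {t | ∃ x ∈ Icc (0 : ℝ) 1, ∃ k, t = greedySum w x k} with hT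
  have hTI : T ⊆ Icc (0 : ℝ) 1 := by
    rintro _ ⟨x, hx, k, rfl⟩
    obtain ⟨h0, h1, -⟩ := greedySum_bounds (fun k => (hw k).2.1) hx.1 k
    exact ⟨h0, h1.trans hx.2⟩
  refine ⟨⟨T, ?_, hTI, fun x hx => ?_, fun r _ => ?_⟩, fun r _ => ⟨fun t => ?_, ?_⟩⟩
  · rintro _ ⟨x, -, k, rfl⟩
    exact greedySum_mem (G := integerSpanSubgroup α) (fun k => (hw k).1) x k
  · exact mem_closure_of_tendsto (tendsto_greedySum (fun k => (hw k).2) hx.1)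
      (Filter.Eventually.of_forall fun k => ⟨x, hx, k, rfl⟩)
  · refine crBounded_image_of_bound (fun t ht => hsm t (hTI ht)) (fun r => ?_) (r + 1)
    obtain ⟨M, hM⟩ := hbd r
    exact ⟨M, fun t ht => hM t (hTI ht)⟩
  · have e : f t = f (Int.fract t) ∘ f (⌊t⌋ : ℝ) := by
      funext y
      rw [Function.comp_apply, ← hf.add_apply hL, Int.fract_add_floor]
    rw [e]
    have h1 := hsm (Int.fract t) ⟨Int.fract_nonneg t, (Int.fract_lt_one t).le⟩
    have h2 := hsmooth ⌊t⌋ (intCast_mem_integerSpan α ⌊t⌋)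
    exact (h1.comp h2).of_le (by exact_mod_cast le_top)
  · exact crBounded_image_of_bound hsm hbd r
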